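/- All logarithms are to base $2$ and $h(x)=-x\log x-(1-x)\log(1-x)$, with $0\log 0=0$. **Codes.** Let $C$ be a binary $t\times n$ matrix with columns $c_1,\dots,c_n$. For $D\subset[n]$ let $\bigvee_{i\in D}c_i$ be the coordinatewise Boolean sum (the zero vector if $D=\emptyset$); a vector $x$ covers $y$ if $x\vee y=x$. $C$ is a $(\le d)$-UF code if $\bigvee_{i\in D_1}c_i\ne\bigvee_{i\in D_2}c_i$ for all $D_1\ne D_2$ with $|D_1|,|D_2|\le d$. It is a $(\le d)$-UFFD code if, moreover, every Boolean sum of at most $d$ columns of $C$ covers at most $n^{1/d}$ columns of $C$. Let $n_{UF}(t,\le d)$ and $n_{UFFD}(t,\le d)$ be the maximal numbers $n$ of columns of such codes of length $t$, and $$R_{UF}(\le d)=\limsup_{t\to\infty}\frac{\log n_{UF}(t,\le d)}{t},\qquad R_{UFFD}(\le d)=\limsup_{t\to\infty}\frac{\log n_{UFFD}(t,\le d)}{t}.$$ **Bounds.** For an integer $s\ge0$, $0<Q<1$ and $q=q(y)=Q\,\frac{1-y^s}{1-y}\le 1$ with $0<y<1$, put $$A(s,Q,q)=(1-q)\log(1-q)+q\log\frac{Qy^s}{1-y}+sQ\log\frac{1-y}{y}+s\,h(Q)$$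 (for $s=0$ one has $q=0$, $A=0$; for $s=1$ one has $q=Q$, $A=0$). For $p\in(0,1)$ and $s\ge 1$ let $$R^{LB}_D(s,p)=\frac1s\,\inf_{q}\Big(A(s,p,q)+h(p)-q\,h\big(\tfrac pq\big)\Big),$$ the infimum being over the values $q=q(y)\le1$, $0<y<1$, with $Q=p$. For $d\ge2$ let $$R^{LB}_{UF}(=d,p)=\inf_{d_0,\alpha,\alpha_0,\alpha_1,\alpha_2}R^{(1)}_{d_0},$$ $$R^{(1)}_{d_0}=-\frac{1}{2d-d_0-1}\Big(F_{bin,h}-A(d_0,p,\alpha_0)-A(d-d_0,p,\alpha_1)-A(d-d_0,p,\alpha_2)\Big),$$ $$F_{bin,h}=h(\alpha)+\alpha h\Big(\frac{\alpha_0}{\alpha}\Big)+\alpha_0h\Big(\frac{\alpha_1+\alpha_0-\alpha}{\alpha_0}\Big)+\alpha_0h\Big(\frac{\alpha_2+\alpha_0-\alpha}{\alpha_0}\Big)-h(\alpha_0)-h(\alpha_1)-h(\alpha_2)$$ (terms with the factor $\alpha_0$ are $0$ if $\alpha_0=0$), where the infimum is over $d_0\in\{0,\dots,d-1\}$ and over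 all $\alpha\le1$, $\alpha_0=p\frac{1-y_0^{d_0}}{1-y_0}$, $\alpha_i=p\frac{1-y_i^{d-d_0}}{1-y_i}$ ($i=1,2$) with $y_0,y_1,y_2\in(0,1)$ such that $\alpha_0\le\alpha$ and $\alpha-\alpha_0\le\alpha_i\le\alpha$ for $i=1,2$. Further let $$R^{(2)}(p)=h(p)-dp\,h\big(\tfrac1d\big),\qquad R^{LB}_{UFFD}(=d,p)=\min\big(R^{LB}_{UF}(=d,p),\,R^{(2)}(p)\big),$$ $$R^{LB}_{UFFD}(\le d,p)=\min\big(R^{LB}_D(d-1,p),\,R^{LB}_{UFFD}(=d,p)\big),$$ $$\mathcal P(d)=\Big\{p\in(0,1):\ R^{LB}_{UFFD}(\le d,p)<h(p)-dp\,h\big(\tfrac1d\big)\Big\}.$$ **Theorem.** For every $d\ge2$, $$R_{UF}(\le d)\ \ge\ \sup_{p\in(0,1)}\min\big(R^{LB}_D(d-1,p),\,R^{LB}_{UF}(=d,p)\big),$$ $$R_{UFFD}(\le d)\ \ge\ \sup_{p\in\mathcal P(d)}\min\big(R^{LB}_D(d-1,p),\,R^{LB}_{UFFD}(=d,p)\big)=\sup_{p\in\mathcal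 P(d)}R^{LB}_{UFFD}(\le d,p),$$ where a supremum over the empty set is $-\infty$. -/

import Mathlib

namespace GroupTesting

/-! Binary `t × n` codes, their columns and Boolean sums of columns. -/

/-- The column `c_j` of a binary matrix. -/
def column {t n : ℕ} (C : Matrix (Fin t) (Fin n) Bool) (j : Fin n) : Fin t → Bool :=
  fun i => C i j

/-- The vector of outcomes for the set `D`: the coordinatewise Boolean sum of the columns `c_j`,
`j ∈ D` (the all-zero vector if `D` is empty). -/
noncomputable def outcome {t n : ℕ} (C : Matrix (Fin t) (Fin n) Bool) (D : Finset (Fin n)) : Fin t → Bool :=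
  D.sup (column C)

/-- The vector `x` covers the vector `y`: the Boolean sum of `x` and `y` is `x`. -/
def Covers {t : ℕ} (x y : Fin t → Bool) : Prop := x ⊔ y = x

/-- The `(≤ d)`-union-free codes. -/
def IsUnionFreeLE {t n : ℕ} (d : ℕ) (C : Matrix (Fin t) (Fin n) Bool) : Prop :=
  ∀ D₁ D₂ : Finset (Fin n), D₁.card ≤ d → D₂.card ≤ d → D₁ ≠ D₂ → outcome C D₁ ≠ outcome C D₂

/-- The `(≤ d)`-union-free codes with fast decoding: moreover, every Boolean sum of at most `d`
columns covers at most `n ^ (1 / d)` columns. -/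
def IsUFFDLE {t n : ℕ} (d : ℕ) (C : Matrix (Fin t) (Fin n) Bool) : Prop :=
  IsUnionFreeLE d C ∧
    ∀ D : Finset (Fin n), D.card ≤ d →
      (({j : Fin n | Covers (outcome C D) (column C j)} : Set (Fin n)).ncard : ℝ)
        ≤ (n : ℝ) ^ ((1 : ℝ) / (d : ℝ))

/-- For `d ≥ 1` a `(≤ d)`-union-free code of length `t` has at most `2 ^ t` columns, so that the
suprema in `maxCardUF` and `maxCardUFFD` are over bounded sets. -/
theorem IsUnionFreeLE.card_le {t n d : ℕ} (hd : 1 ≤ d) {C : Matrix (Fin t) (Fin n) Bool}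
    (hC : IsUnionFreeLE d C) : n ≤ 2 ^ t := by
  have hinj : Function.Injective (column C) := by
    intro i j hij
    by_contra hne
    refine hC {i} {j} (by simpa using hd) (by simpa using hd) (by simpa using hne) ?_
    simpa [outcome] using hij
  simpa using Fintype.card_le_of_injective _ hinj

/-- The maximum cardinality `n_UF(t, ≤ d)` of a `(≤ d)`-union-free code of length `t`. -/
noncomputable def maxCardUF (t d : ℕ) : ℕ :=
  sSup {n : ℕ | ∃ C : Matrix (Fin t) (Fin n) Bool, IsUnionFreeLE d C}

/-- The maximum cardinality `n_UFFD(t, ≤ d)` of a `(≤ d)`-UFFD code of length `t`. -/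
noncomputable def maxCardUFFD (t d : ℕ) : ℕ :=
  sSup {n : ℕ | ∃ C : Matrix (Fin t) (Fin n) Bool, IsUFFDLE d C}

/-- The maximum asymptotic rate `R_UF(≤ d)`. -/
noncomputable def rateUF (d : ℕ) : EReal :=
  Filter.limsup (fun t : ℕ => ((Real.logb 2 (maxCardUF t d : ℝ) / (t : ℝ) : ℝ) : EReal))
    Filter.atTop

/-- The maximum asymptotic rate `R_UFFD(≤ d)`. -/
noncomputable def rateUFFD (d : ℕ) : EReal :=
  Filter.limsup (fun t : ℕ => ((Real.logb 2 (maxCardUFFD t d : ℝ) / (t : ℝ) : ℝ) : EReal))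
    Filter.atTop

/-! The random-coding bounds of the ensemble of independent columns of constant weight `⌊p t⌋`. -/

/-- The binary entropy function, in bits. -/
noncomputable def h (x : ℝ) : ℝ := -x * Real.logb 2 x - (1 - x) * Real.logb 2 (1 - x)

/-- The relative weight `q(y) = Q (1 - y^s) / (1 - y)`, `0 < y < 1`, of a Boolean sum of `s` columns
of relative weight `Q`. -/
noncomputable def q (s : ℕ) (Q y : ℝ) : ℝ := Q * ((1 - y ^ s) / (1 - y))

/-- The exponent `A(s, Q, q)` at `q = q(y)`, as a function of the parameter `y`, `0 < y < 1`. -/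
noncomputable def A (s : ℕ) (Q y : ℝ) : ℝ :=
  (1 - q s Q y) * Real.logb 2 (1 - q s Q y)
    + q s Q y * Real.logb 2 (Q * y ^ s / (1 - y))
    + (s : ℝ) * Q * Real.logb 2 ((1 - y) / y)
    + (s : ℝ) * h Q

/-- The binomial part `F_{bin,h}` of the exponent of a bad pair. -/
noncomputable def Fbin (α α₀ α₁ α₂ : ℝ) : ℝ :=
  h α + α * h (α₀ / α) + α₀ * h ((α₁ + α₀ - α) / α₀) + α₀ * h ((α₂ + α₀ - α) / α₀)
    - h α₀ - h α₁ - h α₂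

/-- `R⁽¹⁾_{d₀}` at relative weights `α`, `α₀ = q(y₀)`, `α₁ = q(y₁)`, `α₂ = q(y₂)`. -/
noncomputable def R₁ (d d₀ : ℕ) (p α y₀ y₁ y₂ : ℝ) : ℝ :=
  -(1 / (2 * (d : ℝ) - (d₀ : ℝ) - 1)) *
    (Fbin α (q d₀ p y₀) (q (d - d₀) p y₁) (q (d - d₀) p y₂)
      - A d₀ p y₀ - A (d - d₀) p y₁ - A (d - d₀) p y₂)

/-- `R⁽²⁾ = h(p) - d p h(1/d)`. -/
noncomputable def R₂ (d : ℕ) (p : ℝ) : ℝ := h p - (d : ℝ) * p * h (1 / (d : ℝ))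

/-- The possible relative weights: `α` that of the common Boolean sum over `D₁` and over `D₂`, and
`α₀`, `α₁`, `α₂` those of the Boolean sums over `D₁ ∩ D₂`, `D₁ \ D₂`, `D₂ \ D₁`, given through
`y₀`, `y₁`, `y₂`; here `|D₁| = |D₂| = d` and `|D₁ ∩ D₂| = d₀ < d`. The bounds
`min p (d₀ p) ≤ α₀ ≤ d₀ p` and `p ≤ α₁, α₂ ≤ (d - d₀) p` hold by the form of `q`, and
`p ≤ α ≤ d p` follows. -/
structure Admissible (d d₀ : ℕ) (p α y₀ y₁ y₂ : ℝ) : Prop where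
  d₀_lt : d₀ < d
  y₀_mem : y₀ ∈ Set.Ioo (0 : ℝ) 1
  y₁_mem : y₁ ∈ Set.Ioo (0 : ℝ) 1
  y₂_mem : y₂ ∈ Set.Ioo (0 : ℝ) 1
  α_le_one : α ≤ 1
  α₀_le : q d₀ p y₀ ≤ α
  α₁_le : q (d - d₀) p y₁ ≤ α
  α₂_le : q (d - d₀) p y₂ ≤ α
  le_α₁ : α - q d₀ p y₀ ≤ q (d - d₀) p y₁
  le_α₂ : α - q d₀ p y₀ ≤ q (d - d₀) p y₂

/-- `R_UF^LB(= d, p)`: the minimum of `R⁽¹⁾_{d₀}` over `d₀`, `α`, `α₀`, `α₁`, `α₂`. -/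
noncomputable def lbUFEq (d : ℕ) (p : ℝ) : EReal :=
  ⨅ (d₀ : ℕ) (α : ℝ) (y₀ : ℝ) (y₁ : ℝ) (y₂ : ℝ) (_ : Admissible d d₀ p α y₀ y₁ y₂),
    ((R₁ d d₀ p α y₀ y₁ y₂ : ℝ) : EReal)

/-- `R_UFFD^LB(= d, p)`: the minimum of `R⁽¹⁾_{d₀}` and `R⁽²⁾`. -/
noncomputable def lbUFFDEq (d : ℕ) (p : ℝ) : EReal :=
  min (lbUFEq d p) ((R₂ d p : ℝ) : EReal)

/-- `R_D^LB(s, p)`, the random-coding bound for `s`-disjunctive codes: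
`(1/s) min_q (A(s, p, q) + h(p) - q h(p/q))`, where `q = q(y)` is the relative weight of a Boolean
sum of `s` columns, and `h(p) - q h(p/q)` is the exponent of the probability that a vector of
relative weight `q` covers a random column. -/
noncomputable def lbDisj (s : ℕ) (p : ℝ) : EReal :=
  ⨅ (y : ℝ) (_ : y ∈ Set.Ioo (0 : ℝ) 1) (_ : q s p y ≤ 1),
    ((1 / (s : ℝ) * (A s p y + h p - q s p y * h (p / q s p y)) : ℝ) : EReal)

/-- `R_UFFD^LB(≤ d, p)`. -/
noncomputable def lbUFFDLe (d : ℕ) (p : ℝ) : EReal := min (lbDisj (d - 1) p) (lbUFFDEq d p)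

/-- The set `𝒫(d)`. -/
def paramSet (d : ℕ) : Set ℝ :=
  {p : ℝ | p ∈ Set.Ioo (0 : ℝ) 1 ∧ lbUFFDLe d p < ((R₂ d p : ℝ) : EReal)}

end GroupTesting

namespace GroupTesting

/-! The bounds come from random coding with expurgation. Draw `2 * N` columns independently and
uniformly among the vectors of weight `w = ⌊p t⌋`, with `N` about `2 ^ (R t)`. A forbidden pattern
on `r` columns whose probability has exponent `μ` occurs at most about `N ^ r * 2 ^ (-t μ)` times in
expectation. This is below any fixed fraction of `N` as soon as `(r - 1) * R < μ`, and deleting one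
column from each occurrence leaves `N` columns that avoid the pattern (`exists_avoids`,
`eventually_exists_avoids`). The factor `r - 1` explains the denominators `s` and `2 d - d₀ - 1` in
the bounds.

Finitely many patterns suffice. If no `d - 1` columns cover another one, two distinct sets of at
most `d` columns with equal Boolean sums both have `d` elements, so only the pair patterns with `d₀
< d` common columns remain (`isUnionFreeLE_codeOf`). For fast decoding one also forbids `d` columns
that cover `m` others, `m` a large constant: a Boolean sum then covers at most `d + m` columns,
which is eventually below `N ^ (1 / d)`. The exponent of this pattern is `m * R₂`, and `(d + m - 1)
* R < m * R₂` holds for large `m` whenever `R < R₂`.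

The probabilities are estimated type by type, a type being the relative weights of the Boolean sums
involved. A generating function bounds the number of `s`-tuples with a prescribed Boolean sum by `2
^ (-t * tilt)` for every tilting parameter in `(0, 1)` (`card_unionFiber_le`), and the best
parameter at weight `q(y)` is `y` itself (`tilt_le_tilt`), which produces `A`. Two difficulties
remain. The infima run over interior parameters `y` only, while actual types may lie on the
boundary; `tilt` is affine in the weight, so a boundary type is mixed with a little of an interior
one (`exists_lt_pairExponent`, `exists_lt_disjExponent`). Also `w / t` only tends to `p`, so the
estimates must be uniform near `p`; compactness of the set of types gives this. -/

/-! ### Binary entropy and binomial coefficients -/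

theorem h_eq_binEntropy (x : ℝ) : h x = Real.binEntropy x / Real.log 2 := by
  simp only [h, Real.binEntropy, Real.logb, Real.log_inv]
  ring

theorem continuous_h : Continuous h := by
  have : h = fun x => Real.binEntropy x / Real.log 2 := funext h_eq_binEntropy
  rw [this]
  exact Real.binEntropy_continuous.div_const _

theorem pow_eq_two_rpow {x : ℝ} (hx : 0 < x) (k : ℕ) :
    x ^ k = (2 : ℝ) ^ ((k : ℝ) * Real.logb 2 x) := by
  rw [mul_comm, Real.rpow_mul (by norm_num), Real.rpow_logb (by norm_num) (by norm_num) hx,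
    Real.rpow_natCast]

theorem two_rpow_neg_mul_h {n k : ℕ} (hk : k ≤ n) :
    (2 : ℝ) ^ (-((n : ℝ) * h ((k : ℝ) / n)))
      = ((k : ℝ) / n) ^ k * (1 - (k : ℝ) / n) ^ (n - k) := by
  rcases Nat.eq_zero_or_pos k with rfl | hk0
  · simp [h]
  have hn : (0 : ℝ) < n := by exact_mod_cast hk0.trans_le hk
  have hk0' : (0 : ℝ) < k := by exact_mod_cast hk0
  rcases hk.eq_or_lt with rfl | hlt
  · simp [h, div_self hn.ne']
  have hlt' : (k : ℝ) < n := by exact_mod_cast hlt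
  have h1 : 0 < 1 - (k : ℝ) / n := by
    rw [sub_pos, div_lt_one hn]; exact hlt'
  rw [pow_eq_two_rpow (div_pos hk0' hn), pow_eq_two_rpow h1, ← Real.rpow_add (by norm_num),
    Nat.cast_sub hk]
  congr 1
  simp only [h]
  field_simp
  ring

/-- The left side is a single term of the expansion of `(x + (1 - x)) ^ n = 1` at `x = k / n`. -/
theorem choose_mul_two_rpow_le {n k : ℕ} (hk : k ≤ n) :
    (n.choose k : ℝ) * (2 : ℝ) ^ (-((n : ℝ) * h ((k : ℝ) / n))) ≤ 1 := by
  rw [two_rpow_neg_mul_h hk]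
  rcases Nat.eq_zero_or_pos n with rfl | hn
  · obtain rfl : k = 0 := by omega
    simp
  have hn' : (0 : ℝ) < n := by exact_mod_cast hn
  have hkn : (k : ℝ) ≤ n := by exact_mod_cast hk
  have h0 : 0 ≤ (k : ℝ) / n := by positivity
  have h1 : 0 ≤ 1 - (k : ℝ) / n := by
    rw [sub_nonneg, div_le_one hn']; exact hkn
  have := add_pow ((k : ℝ) / n) (1 - (k : ℝ) / n) n
  rw [add_sub_cancel, one_pow] at this
  refine le_of_le_of_eq ?_ this.symm
  refine le_trans (le_of_eq (by ring)) (Finset.single_le_sum (f := fun m => ((k : ℝ) / n) ^ m *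
    (1 - (k : ℝ) / n) ^ (n - m) * (n.choose m : ℝ)) (fun i _ => by positivity)
    (Finset.mem_range.2 (Nat.lt_succ_of_le hk)))

theorem two_rpow_neg_le_inv_choose {n k : ℕ} (hk : k ≤ n) :
    (2 : ℝ) ^ (-((n : ℝ) * h ((k : ℝ) / n))) ≤ ((n.choose k : ℝ))⁻¹ := by
  have : (0 : ℝ) < n.choose k := by exact_mod_cast Nat.choose_pos hk
  rw [← one_div, le_div_iff₀ this, mul_comm]
  exact choose_mul_two_rpow_le hk

theorem factorial_add_le_factorial_mul_pow (l m : ℕ) :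
    (l + m).factorial ≤ l.factorial * (l + m) ^ m := by
  have := Nat.factorial_mul_descFactorial (Nat.le_add_left m l)
  rw [Nat.add_sub_cancel] at this
  rw [← this]
  exact Nat.mul_le_mul_left _ (Nat.descFactorial_le_pow _ _)

/-- The term of index `k` is the largest in the expansion of `(k + (n - k)) ^ n`. -/
theorem choose_mul_pow_le_of_mode {n k j : ℕ} (hk : k ≤ n) (hj : j ≤ n) :
    n.choose j * (k ^ j * (n - k) ^ (n - j)) ≤ n.choose k * (k ^ k * (n - k) ^ (n - k)) := by
  -- With factorials cleared and common powers cancelled, only two comparisons are needed: a product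
  -- of `m` consecutive integers above `k` is at least `k ^ m`, and one of `m` consecutive integers
  -- up to `N` is at most `N ^ m`.
  have hfac : k.factorial * (n - k).factorial * (k ^ j * (n - k) ^ (n - j))
      ≤ j.factorial * (n - j).factorial * (k ^ k * (n - k) ^ (n - k)) := by
    rcases le_total k j with hkj | hjk
    · obtain ⟨m, rfl⟩ := Nat.exists_eq_add_of_le hkj
      obtain ⟨l, rfl⟩ := Nat.exists_eq_add_of_le hj
      have e1 : k + m + l - k = m + l := by omega
      have e2 : k + m + l - (k + m) = l := by omega
      rw [e1, e2]
      have a1 : k.factorial * k ^ m ≤ (k + m).factorial :=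
        (Nat.mul_le_mul_left _ (Nat.pow_le_pow_left (Nat.le_succ k) m)).trans
          (Nat.factorial_mul_pow_le_factorial)
      have a2 : (m + l).factorial ≤ l.factorial * (m + l) ^ m := by
        rw [add_comm m l]
        exact factorial_add_le_factorial_mul_pow l m
      calc k.factorial * (m + l).factorial * (k ^ (k + m) * (m + l) ^ l)
          = (k.factorial * k ^ m) * (m + l).factorial * (k ^ k * (m + l) ^ l) := by ring
        _ ≤ (k + m).factorial * (l.factorial * (m + l) ^ m) * (k ^ k * (m + l) ^ l) := by gcongr
        _ = _ := by ring
    · obtain ⟨m, rfl⟩ := Nat.exists_eq_add_of_le hjk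
      obtain ⟨l, rfl⟩ := Nat.exists_eq_add_of_le hk
      have e1 : j + m + l - j = m + l := by omega
      have e2 : j + m + l - (j + m) = l := by omega
      rw [e1, e2]
      have a1 : l.factorial * l ^ m ≤ (m + l).factorial := by
        rw [add_comm m l]
        exact (Nat.mul_le_mul_left _ (Nat.pow_le_pow_left (Nat.le_succ l) m)).trans
          (Nat.factorial_mul_pow_le_factorial)
      have a2 : (j + m).factorial ≤ j.factorial * (j + m) ^ m := factorial_add_le_factorial_mul_pow j m
      calc (j + m).factorial * l.factorial * ((j + m) ^ j * l ^ (m + l))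
          = (j + m).factorial * (l.factorial * l ^ m) * ((j + m) ^ j * l ^ l) := by ring
        _ ≤ (j.factorial * (j + m) ^ m) * (m + l).factorial * ((j + m) ^ j * l ^ l) := by gcongr
        _ = _ := by ring
  have c1 := Nat.choose_mul_factorial_mul_factorial hj
  have c2 := Nat.choose_mul_factorial_mul_factorial hk
  have pos : 0 < j.factorial * (n - j).factorial * (k.factorial * (n - k).factorial) := by positivity
  refine Nat.le_of_mul_le_mul_left ?_ pos
  calc _ = (n.choose j * j.factorial * (n - j).factorial) *
        (k.factorial * (n - k).factorial * (k ^ j * (n - k) ^ (n - j))) := by ring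
    _ ≤ (n.choose k * k.factorial * (n - k).factorial) *
        (j.factorial * (n - j).factorial * (k ^ k * (n - k) ^ (n - k))) := by
          rw [c1, c2]; exact Nat.mul_le_mul_left _ hfac
    _ = _ := by ring

/-- The expansion of `n ^ n = (k + (n - k)) ^ n` has `n + 1` terms, of which the one of index `k` is
the largest. -/
theorem two_rpow_le_choose {n k : ℕ} (hk : k ≤ n) :
    (2 : ℝ) ^ ((n : ℝ) * h ((k : ℝ) / n)) ≤ ((n : ℝ) + 1) * n.choose k := by
  have key : (n : ℝ) ^ n ≤ (n + 1) * (n.choose k * ((k : ℝ) ^ k * ((n : ℝ) - k) ^ (n - k))) := by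
    have h1 : n ^ n ≤ (n + 1) * (n.choose k * (k ^ k * (n - k) ^ (n - k))) := by
      calc n ^ n = (k + (n - k)) ^ n := by rw [Nat.add_sub_cancel' hk]
        _ = ∑ j ∈ Finset.range (n + 1), k ^ j * (n - k) ^ (n - j) * n.choose j := add_pow _ _ _
        _ ≤ ∑ _j ∈ Finset.range (n + 1), n.choose k * (k ^ k * (n - k) ^ (n - k)) := by
          refine Finset.sum_le_sum fun j hj => ?_
          rw [mul_comm]
          exact choose_mul_pow_le_of_mode hk (Nat.lt_succ_iff.1 (Finset.mem_range.1 hj))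
        _ = _ := by simp
    have := (Nat.cast_le (α := ℝ)).2 h1
    push_cast [Nat.cast_sub hk] at this
    exact this
  have e := two_rpow_neg_mul_h hk
  rcases Nat.eq_zero_or_pos n with rfl | hn
  · obtain rfl : k = 0 := by omega
    simp
  have hn' : (0 : ℝ) < n := by exact_mod_cast hn
  have e2 : (2 : ℝ) ^ (-((n : ℝ) * h ((k : ℝ) / n))) * (n : ℝ) ^ n
      = (k : ℝ) ^ k * ((n : ℝ) - k) ^ (n - k) := by
    rw [e, div_pow, one_sub_div hn'.ne', div_pow]
    conv_lhs => rw [← Nat.add_sub_cancel' hk, pow_add]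
    rw [Nat.add_sub_cancel' hk]
    field_simp
  rw [← e2] at key
  have hpos : (0 : ℝ) < (n : ℝ) ^ n := by positivity
  rw [Real.rpow_neg (by norm_num)] at key
  have h2 : (0 : ℝ) < (2 : ℝ) ^ ((n : ℝ) * h ((k : ℝ) / n)) := by positivity
  have : 1 ≤ (n + 1) * (n.choose k : ℝ) * ((2 : ℝ) ^ ((n : ℝ) * h ((k : ℝ) / n)))⁻¹ := by
    refine le_of_mul_le_mul_right ?_ hpos
    linarith
  rwa [← div_eq_mul_inv, one_le_div h2] at this

/-- Each cardinality from `0` to `S.card` contributes exactly `1`. Weighting sets by inverse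
binomials thus replaces the count of types. -/
theorem sum_powerset_inv_choose {ι : Type*} (S : Finset ι) :
    ∑ V ∈ S.powerset, ((S.card.choose V.card : ℝ))⁻¹ = S.card + 1 := by
  rw [Finset.sum_powerset_apply_card (fun m => ((S.card.choose m : ℝ))⁻¹)]
  rw [Finset.sum_congr rfl (g := fun _ => (1 : ℝ))]
  · simp
  · intro m hm
    have : (S.card.choose m : ℝ) ≠ 0 := by
      exact_mod_cast (Nat.choose_pos (Nat.lt_succ_iff.1 (Finset.mem_range.1 hm))).ne'
    simp [nsmul_eq_mul, mul_inv_cancel₀ this]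

/-! ### Relative weights and the tilted exponent -/

open Set

/-- The relative weight `q s Q y` as a polynomial, which extends it to `y = 1`. -/
noncomputable def wt (s : ℕ) (Q y : ℝ) : ℝ := Q * ∑ i ∈ Finset.range s, y ^ i

theorem q_eq_wt (s : ℕ) (Q : ℝ) {y : ℝ} (hy : y < 1) : q s Q y = wt s Q y := by
  have h1 : 1 - y ≠ 0 := by linarith
  rw [q, wt, geom_sum_eq hy.ne, ← neg_div_neg_eq, neg_sub, neg_sub]

theorem continuous_wt (s : ℕ) : Continuous fun x : ℝ × ℝ => wt s x.1 x.2 := by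
  unfold wt; fun_prop

theorem continuous_wt_right (s : ℕ) (Q : ℝ) : Continuous fun y => wt s Q y := by
  unfold wt; fun_prop

@[simp] theorem wt_zero_left (Q y : ℝ) : wt 0 Q y = 0 := by simp [wt]

theorem wt_zero_right {s : ℕ} (hs : 1 ≤ s) (Q : ℝ) : wt s Q 0 = Q := by
  obtain ⟨k, rfl⟩ := Nat.exists_eq_add_of_le' hs
  simp [wt, Finset.sum_range_succ']

theorem wt_one_right (s : ℕ) (Q : ℝ) : wt s Q 1 = Q * s := by simp [wt]

theorem wt_mono (s : ℕ) {Q : ℝ} (hQ : 0 ≤ Q) {y z : ℝ} (hy : 0 ≤ y) (hyz : y ≤ z) :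
    wt s Q y ≤ wt s Q z := by
  unfold wt; gcongr

theorem wt_nonneg (s : ℕ) {Q y : ℝ} (hQ : 0 ≤ Q) (hy : 0 ≤ y) : 0 ≤ wt s Q y := by
  unfold wt; positivity

theorem le_wt {s : ℕ} (hs : 1 ≤ s) {Q y : ℝ} (hQ : 0 ≤ Q) (hy : 0 ≤ y) : Q ≤ wt s Q y := by
  simpa [wt_zero_right hs] using wt_mono s hQ le_rfl hy

/-- The exponent of the Chernoff bound with tilting parameter `y` for the number of `s`-tuples of
vectors of relative weight `Q` whose Boolean sum is a given vector of relative weight `x`. -/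
noncomputable def tilt (s : ℕ) (Q x y : ℝ) : ℝ :=
  -(x * Real.logb 2 ((1 - y ^ s) / y ^ s)) + (s : ℝ) * Q * Real.logb 2 ((1 - y) / y)

theorem tilt_combo (s : ℕ) (Q x x' y l : ℝ) :
    tilt s Q ((1 - l) * x + l * x') y = (1 - l) * tilt s Q x y + l * tilt s Q x' y := by
  unfold tilt; ring

theorem wt_pos {s : ℕ} (hs : 1 ≤ s) {Q y : ℝ} (hQ : 0 < Q) (hy : 0 ≤ y) : 0 < wt s Q y :=
  hQ.trans_le (le_wt hs hQ.le hy)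

/-- There are about `2 ^ (t * h q)` sets of relative weight `q`, each the Boolean sum of about `2 ^
(-t * tilt)` of the roughly `2 ^ (t * s * h Q)` tuples. Hence `A` is the exponent of the probability
that a Boolean sum of `s` random columns has relative weight `q`. For `s = 0` the identity relies on
`Real.logb 2 0 = 0`. -/
theorem A_eq_tilt (s : ℕ) {Q y : ℝ} (hQ : 0 < Q) (hy : y ∈ Ioo (0 : ℝ) 1) :
    A s Q y = tilt s Q (wt s Q y) y + s * h Q - h (wt s Q y) := by
  rw [A, q_eq_wt s Q hy.2]
  rcases Nat.eq_zero_or_pos s with rfl | hs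
  · simp [tilt, h]
  have hw : 0 < wt s Q y := wt_pos hs hQ hy.1.le
  have hys : 0 < y ^ s := pow_pos hy.1 s
  have h1 : 0 < 1 - y ^ s := by
    have := pow_lt_one₀ hy.1.le hy.2 (Nat.pos_iff_ne_zero.1 hs)
    linarith
  have h2 : 0 < 1 - y := by linarith [hy.2]
  have e : Q * y ^ s / (1 - y) = wt s Q y / ((1 - y ^ s) / y ^ s) := by
    rw [← q_eq_wt s Q hy.2, q]
    field_simp
  rw [e, Real.logb_div hw.ne' (div_pos h1 hys).ne']
  simp only [tilt, h]
  ring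

/-- The tilting parameter `y` is optimal at the relative weight `wt s Q y`. -/
theorem tilt_le_tilt (s : ℕ) {Q y z : ℝ} (hQ : 0 < Q) (hy : y ∈ Ioo (0 : ℝ) 1)
    (hz : z ∈ Ioo (0 : ℝ) 1) : tilt s Q (wt s Q y) z ≤ tilt s Q (wt s Q y) y := by
  rcases Nat.eq_zero_or_pos s with rfl | hs
  · simp [tilt]
  set W := wt s Q y with hW
  let F : ℝ → ℝ := fun u => W * (Real.log (1 - u ^ s) - s * Real.log u)
    - s * Q * (Real.log (1 - u) - Real.log u)
  have hpow : ∀ u ∈ Ioo (0 : ℝ) 1, 0 < 1 - u ^ s := fun u hu => by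
    have := pow_lt_one₀ hu.1.le hu.2 (Nat.pos_iff_ne_zero.1 hs)
    linarith
  have hF : ∀ u ∈ Ioo (0 : ℝ) 1, tilt s Q W u = -(F u / Real.log 2) := fun u hu => by
    have h1 := hpow u hu
    have h2 : 0 < 1 - u := by linarith [hu.2]
    simp only [tilt, Real.logb, F]
    rw [Real.log_div h1.ne' (pow_pos hu.1 s).ne', Real.log_div h2.ne' hu.1.ne', Real.log_pow]
    ring
  -- The derivative has the sign of `wt s Q u - W`; since `wt` is monotone, `F` decreases up to `y`
  -- and increases after it.
  have hder : ∀ u ∈ Ioo (0 : ℝ) 1,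
      HasDerivAt F (s / (u * (1 - u ^ s)) * (wt s Q u - W)) u := fun u hu => by
    have h1 := hpow u hu
    have h2 : 0 < 1 - u := by linarith [hu.2]
    have d1 : HasDerivAt (fun u : ℝ => Real.log (1 - u ^ s))
        (-((s : ℝ) * u ^ (s - 1)) / (1 - u ^ s)) u := by
      simpa using ((hasDerivAt_pow s u).const_sub 1).log h1.ne'
    have d2 : HasDerivAt (fun u : ℝ => Real.log (1 - u)) (-1 / (1 - u)) u := by
      simpa using ((hasDerivAt_id u).const_sub 1).log h2.ne'
    have d3 := Real.hasDerivAt_log hu.1.ne'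
    refine (((d1.sub (d3.const_mul (s : ℝ))).const_mul W).sub
      ((d2.sub d3).const_mul (s * Q))).congr_deriv ?_
    rw [← q_eq_wt s Q hu.2, q]
    have hu0 := hu.1.ne'
    have e : u ^ s = u * u ^ (s - 1) := by
      rw [← pow_succ', Nat.sub_add_cancel hs]
    have h1' := h1.ne'
    have h2' := h2.ne'
    rw [e] at h1' ⊢
    generalize u ^ (s - 1) = v at h1' ⊢
    -- The denominator `1 - u ^ s` is made an atom so that `field_simp` can clear it.
    obtain ⟨D, hD⟩ : ∃ D, D = 1 - u * v := ⟨_, rfl⟩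
    obtain rfl : v = (1 - D) / u := by rw [hD]; field_simp; ring
    rw [← hD] at h1' ⊢
    field_simp
    ring
  have hcont : ContinuousOn F (Ioo (0 : ℝ) 1) := fun u hu => (hder u hu).continuousAt.continuousWithinAt
  have key : F y ≤ F z := by
    rcases le_total y z with hyz | hzy
    · have hsub : Icc y z ⊆ Ioo (0 : ℝ) 1 := fun u hu => ⟨hy.1.trans_le hu.1, hu.2.trans_lt hz.2⟩
      have : MonotoneOn F (Icc y z) := by
        refine monotoneOn_of_deriv_nonneg (convex_Icc y z) (hcont.mono hsub)
          (fun u hu => (hder u (hsub (interior_subset hu))).differentiableAt.differentiableWithinAt)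
          (fun u hu => ?_)
        have hu' := hsub (interior_subset hu)
        rw [(hder u hu').deriv]
        have := hpow u hu'
        have := wt_mono s hQ.le hy.1.le (interior_subset hu).1
        have h3 := hu'.1
        apply mul_nonneg (by positivity)
        linarith
      exact this (left_mem_Icc.2 hyz) (right_mem_Icc.2 hyz) hyz
    · have hsub : Icc z y ⊆ Ioo (0 : ℝ) 1 := fun u hu => ⟨hz.1.trans_le hu.1, hu.2.trans_lt hy.2⟩
      have : AntitoneOn F (Icc z y) := by
        refine antitoneOn_of_deriv_nonpos (convex_Icc z y) (hcont.mono hsub)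
          (fun u hu => (hder u (hsub (interior_subset hu))).differentiableAt.differentiableWithinAt)
          (fun u hu => ?_)
        have hu' := hsub (interior_subset hu)
        rw [(hder u hu').deriv]
        have := hpow u hu'
        have := wt_mono s hQ.le hu'.1.le (interior_subset hu).2
        have h3 := hu'.1
        apply mul_nonpos_of_nonneg_of_nonpos (by positivity)
        linarith
      exact this (left_mem_Icc.2 hzy) (right_mem_Icc.2 hzy) hzy
  rw [hF y hy, hF z hz]
  have := Real.log_pos (one_lt_two)
  gcongr

/-- A convex combination of a relative weight with an interior one is interior. -/
theorem exists_wt_eq_combo (s : ℕ) (Q : ℝ) {a y l : ℝ} (ha : a ∈ Icc (0 : ℝ) 1)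
    (hy : y ∈ Ioo (0 : ℝ) 1) (hl : l ∈ Ioc (0 : ℝ) 1) :
    ∃ z ∈ Ioo (0 : ℝ) 1, wt s Q z = (1 - l) * wt s Q a + l * wt s Q y := by
  have hmem : (1 - l) * wt s Q a + l * wt s Q y ∈ uIcc (wt s Q a) (wt s Q y) := by
    rw [← segment_eq_uIcc]
    exact ⟨1 - l, l, by linarith [hl.2], hl.1.le, by ring, rfl⟩
  obtain ⟨z, hz, hzw⟩ := intermediate_value_uIcc (continuous_wt_right s Q).continuousOn hmem
  -- The intermediate value may be attained at the possibly non-interior end `a`. Then both ends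
  -- have the same weight, because `l ≠ 0`, and `y` serves instead.
  by_cases hza : z = a
  · refine ⟨y, hy, ?_⟩
    rw [hza] at hzw
    change wt s Q a = _ at hzw
    have : l * (wt s Q a - wt s Q y) = 0 := by linarith
    rcases mul_eq_zero.1 this with h0 | h0
    · exact absurd h0 hl.1.ne'
    · rw [sub_eq_zero.1 h0]; ring
  · refine ⟨z, ?_, hzw⟩
    rcases le_total a y with hay | hya
    · rw [uIcc_of_le hay] at hz
      exact ⟨ha.1.trans_lt (lt_of_le_of_ne hz.1 (Ne.symm hza)), hz.2.trans_lt hy.2⟩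
    · rw [uIcc_of_ge hya] at hz
      exact ⟨hy.1.trans_le hz.1, (lt_of_le_of_ne hz.2 hza).trans_le ha.2⟩

/-- Moving from an interior relative weight `wt s Q y` towards `x` loses little in the exponent. -/
theorem tilt_combo_le (s : ℕ) {Q x y z l : ℝ} (hQ : 0 < Q) (hy : y ∈ Ioo (0 : ℝ) 1)
    (hz : z ∈ Ioo (0 : ℝ) 1) (hl : 0 ≤ l) :
    tilt s Q ((1 - l) * x + l * wt s Q y) z - l * tilt s Q (wt s Q y) y ≤ (1 - l) * tilt s Q x z := by
  rw [tilt_combo]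
  have := mul_le_mul_of_nonneg_left (tilt_le_tilt s hQ hy hz) hl
  linarith

theorem continuous_tilt (s : ℕ) (y : ℝ) : Continuous fun v : ℝ × ℝ => tilt s v.1 v.2 y := by
  unfold tilt; fun_prop

/-! ### Exponents at boundary types and uniformity in the column weight -/

open Set Filter Topology

/-- The exponent of the number of triples of vectors of relative weights `x₀`, `x₁`, `x₂` such that
the Boolean sums of the first with the second and with the third are the same, of relative
weight `α`. -/
noncomputable def pairEntropy (α x₀ x₁ x₂ : ℝ) : ℝ :=
  h α + α * h (x₀ / α) + x₀ * h ((x₁ + x₀ - α) / x₀) + x₀ * h ((x₂ + x₀ - α) / x₀)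

/-- The exponent of a bad pair, with free tilting parameters. -/
noncomputable def pairExponent (d d₀ : ℕ) (p α x₀ x₁ x₂ y₀ y₁ y₂ : ℝ) : ℝ :=
  tilt d₀ p x₀ y₀ + tilt (d - d₀) p x₁ y₁ + tilt (d - d₀) p x₂ y₂ + (2 * (d : ℝ) - d₀) * h p
    - pairEntropy α x₀ x₁ x₂

/-- The exponent of a Boolean sum of `s` columns covering another one, with a free tilting
parameter. -/
noncomputable def disjExponent (s : ℕ) (p x y : ℝ) : ℝ :=
  tilt s p x y + ((s : ℝ) + 1) * h p - h x - x * h (p / x)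

/-- The entropies of the three weights subtracted in `Fbin` cancel those contained in the three
terms `A`. -/
theorem R₁_eq_pairExponent {d d₀ : ℕ} (hd : d₀ < d) {p α y₀ y₁ y₂ : ℝ} (hp : 0 < p)
    (h₀ : y₀ ∈ Ioo (0 : ℝ) 1) (h₁ : y₁ ∈ Ioo (0 : ℝ) 1) (h₂ : y₂ ∈ Ioo (0 : ℝ) 1) :
    (2 * (d : ℝ) - d₀ - 1) * R₁ d d₀ p α y₀ y₁ y₂
      = pairExponent d d₀ p α (wt d₀ p y₀) (wt (d - d₀) p y₁) (wt (d - d₀) p y₂) y₀ y₁ y₂ := by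
  have hpos : (0 : ℝ) < 2 * (d : ℝ) - d₀ - 1 := by
    have h1 : (d₀ : ℝ) + 1 ≤ d := by exact_mod_cast hd
    have h2 : (0 : ℝ) ≤ d₀ := by positivity
    linarith
  rw [R₁, A_eq_tilt _ hp h₀, A_eq_tilt _ hp h₁, A_eq_tilt _ hp h₂, q_eq_wt _ _ h₀.2,
    q_eq_wt _ _ h₁.2, q_eq_wt _ _ h₂.2, Nat.cast_sub hd.le]
  rw [mul_comm, neg_mul, neg_mul, mul_assoc, mul_comm _ (2 * (d : ℝ) - d₀ - 1), ← mul_assoc,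
    one_div_mul_cancel hpos.ne', Fbin, pairExponent, pairEntropy]
  ring

theorem disjExponent_eq {s : ℕ} {p y : ℝ} (hp : 0 < p) (hy : y ∈ Ioo (0 : ℝ) 1) :
    A s p y + h p - q s p y * h (p / q s p y) = disjExponent s p (wt s p y) y := by
  rw [A_eq_tilt _ hp hy, q_eq_wt _ _ hy.2, disjExponent]
  ring

/-- The quotients by `x₀` prevent a continuity argument at `x₀ = 0`. That value arises only for `d₀
= 0`, where the weight vanishes identically. -/
theorem tendsto_pairEntropy {X : Type*} {l : Filter X} {f f₀ f₁ f₂ : X → ℝ} {α x₀ x₁ x₂ : ℝ}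
    (hf : Tendsto f l (𝓝 α)) (hf₀ : Tendsto f₀ l (𝓝 x₀)) (hf₁ : Tendsto f₁ l (𝓝 x₁))
    (hf₂ : Tendsto f₂ l (𝓝 x₂)) (hα : 0 < α) (hx₀ : 0 < x₀ ∨ (x₀ = 0 ∧ ∀ n, f₀ n = 0)) :
    Tendsto (fun n => pairEntropy (f n) (f₀ n) (f₁ n) (f₂ n)) l (𝓝 (pairEntropy α x₀ x₁ x₂)) := by
  have hc : ∀ {g : X → ℝ} {a : ℝ}, Tendsto g l (𝓝 a) → Tendsto (fun n => h (g n)) l (𝓝 (h a)) :=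
    fun hg => (continuous_h.tendsto _).comp hg
  have hmain := (hc hf).add (hf.mul (hc (hf₀.div hf hα.ne')))
  unfold pairEntropy
  rcases hx₀ with h0 | ⟨rfl, h0⟩
  · exact (hmain.add (hf₀.mul (hc (((hf₁.add hf₀).sub hf).div hf₀ h0.ne')))).add
      (hf₀.mul (hc (((hf₂.add hf₀).sub hf).div hf₀ h0.ne')))
  · simpa [h0] using hmain

/-- The constraints on the relative weights of a bad pair. -/
structure PairCompat (α x₀ x₁ x₂ : ℝ) : Prop where
  le_one : α ≤ 1
  le₀ : x₀ ≤ α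
  le₁ : x₁ ≤ α
  le₂ : x₂ ≤ α
  sub_le₁ : α - x₀ ≤ x₁
  sub_le₂ : α - x₀ ≤ x₂

theorem admissible_iff {d d₀ : ℕ} {p α y₀ y₁ y₂ : ℝ} (hd : d₀ < d) (h₀ : y₀ ∈ Ioo (0 : ℝ) 1)
    (h₁ : y₁ ∈ Ioo (0 : ℝ) 1) (h₂ : y₂ ∈ Ioo (0 : ℝ) 1) :
    Admissible d d₀ p α y₀ y₁ y₂ ↔
      PairCompat α (wt d₀ p y₀) (wt (d - d₀) p y₁) (wt (d - d₀) p y₂) := by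
  simp only [← q_eq_wt _ _ h₀.2, ← q_eq_wt _ _ h₁.2, ← q_eq_wt _ _ h₂.2]
  exact ⟨fun H => ⟨H.α_le_one, H.α₀_le, H.α₁_le, H.α₂_le, H.le_α₁, H.le_α₂⟩,
    fun H => ⟨hd, h₀, h₁, h₂, H.le_one, H.le₀, H.le₁, H.le₂, H.sub_le₁, H.sub_le₂⟩⟩

theorem PairCompat.combo {α x₀ x₁ x₂ α' x₀' x₁' x₂' l : ℝ} (H : PairCompat α x₀ x₁ x₂)
    (H' : PairCompat α' x₀' x₁' x₂') (hl : 0 ≤ l) (hl1 : l ≤ 1) :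
    PairCompat ((1 - l) * α + l * α') ((1 - l) * x₀ + l * x₀') ((1 - l) * x₁ + l * x₁')
      ((1 - l) * x₂ + l * x₂') := by
  have hl' : 0 ≤ 1 - l := by linarith
  have key : ∀ {a b c e : ℝ}, a ≤ b → c ≤ e → (1 - l) * a + l * c ≤ (1 - l) * b + l * e :=
    fun h1 h2 => add_le_add (mul_le_mul_of_nonneg_left h1 hl') (mul_le_mul_of_nonneg_left h2 hl)
  refine ⟨?_, key H.le₀ H'.le₀, key H.le₁ H'.le₁, key H.le₂ H'.le₂, ?_, ?_⟩
  · linarith [key H.le_one H'.le_one]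
  · linarith [key H.sub_le₁ H'.sub_le₁]
  · linarith [key H.sub_le₂ H'.sub_le₂]

theorem exists_wt_le_one (s : ℕ) {p : ℝ} (hp : p ∈ Ioo (0 : ℝ) 1) :
    ∀ᶠ y in 𝓝[>] (0 : ℝ), wt s p y ≤ 1 := by
  have h0 : wt s p 0 < 1 := by
    rcases Nat.eq_zero_or_pos s with rfl | hs
    · simp
    · rw [wt_zero_right hs]; exact hp.2
  have := (continuous_wt_right s p).tendsto 0
  exact nhdsWithin_le_nhds ((this.eventually (gt_mem_nhds h0)).mono fun y hy => hy.le)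

/-- Supplies an interior type to mix with: for `y` near `0` the weights are at most `1`, and the
larger of them can serve as the weight of the common Boolean sum. -/
theorem exists_pairCompat (s s' : ℕ) {p : ℝ} (hp : p ∈ Ioo (0 : ℝ) 1) :
    ∃ α, ∃ y ∈ Ioo (0 : ℝ) 1, PairCompat α (wt s p y) (wt s' p y) (wt s' p y) := by
  obtain ⟨y, ⟨h1, h2⟩, h3⟩ := (((exists_wt_le_one s hp).and (exists_wt_le_one s' hp)).and
    (Ioo_mem_nhdsGT (zero_lt_one' ℝ))).exists
  have n1 := wt_nonneg s hp.1.le h3.1.le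
  have n2 := wt_nonneg s' hp.1.le h3.1.le
  refine ⟨max (wt s p y) (wt s' p y), y, h3, max_le h1 h2, le_max_left _ _, le_max_right _ _,
    le_max_right _ _, ?_, ?_⟩ <;>
  · rw [sub_le_iff_le_add]
    exact max_le (by linarith) (by linarith)

/-- At every possible type, also a boundary one, suitable tilting parameters yield an exponent
almost as good as at the interior types. -/
theorem exists_lt_pairExponent {d d₀ : ℕ} (hd : d₀ < d) {p : ℝ} (hp : p ∈ Ioo (0 : ℝ) 1)
    {ν ν' : ℝ} (hν : ν < ν')
    (hA : ∀ α y₀ y₁ y₂, Admissible d d₀ p α y₀ y₁ y₂ →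
      ν' ≤ (2 * (d : ℝ) - d₀ - 1) * R₁ d d₀ p α y₀ y₁ y₂)
    {α a₀ a₁ a₂ : ℝ} (h₀ : a₀ ∈ Icc (0 : ℝ) 1) (h₁ : a₁ ∈ Icc (0 : ℝ) 1) (h₂ : a₂ ∈ Icc (0 : ℝ) 1)
    (H : PairCompat α (wt d₀ p a₀) (wt (d - d₀) p a₁) (wt (d - d₀) p a₂)) :
    ∃ y₀ ∈ Ioo (0 : ℝ) 1, ∃ y₁ ∈ Ioo (0 : ℝ) 1, ∃ y₂ ∈ Ioo (0 : ℝ) 1,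
      ν < pairExponent d d₀ p α (wt d₀ p a₀) (wt (d - d₀) p a₁) (wt (d - d₀) p a₂) y₀ y₁ y₂ := by
  obtain ⟨β, y, hy, H'⟩ := exists_pairCompat d₀ (d - d₀) hp
  set x₀ := wt d₀ p a₀ with hx₀
  set x₁ := wt (d - d₀) p a₁ with hx₁
  set x₂ := wt (d - d₀) p a₂ with hx₂
  set c := (2 * (d : ℝ) - d₀) * h p with hc
  set T := tilt d₀ p (wt d₀ p y) y + tilt (d - d₀) p (wt (d - d₀) p y) y
    + tilt (d - d₀) p (wt (d - d₀) p y) y with hT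
  have hαpos : 0 < α := (wt_pos (Nat.sub_pos_of_lt hd) hp.1 h₁.1).trans_le H.le₁
  let mix : ℝ → ℝ → ℝ → ℝ := fun u v l => (1 - l) * u + l * v
  have hmix : ∀ u v, Tendsto (mix u v) (𝓝[>] 0) (𝓝 u) := fun u v => by
    have : Continuous (mix u v) := by fun_prop
    have := this.tendsto 0
    simp only [mix, sub_zero, one_mul, zero_mul, add_zero] at this
    exact this.mono_left nhdsWithin_le_nhds
  have hent : Tendsto (fun l => pairEntropy (mix α β l) (mix x₀ (wt d₀ p y) l)
      (mix x₁ (wt (d - d₀) p y) l) (mix x₂ (wt (d - d₀) p y) l)) (𝓝[>] 0)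
      (𝓝 (pairEntropy α x₀ x₁ x₂)) := by
    refine tendsto_pairEntropy (hmix _ _) (hmix _ _) (hmix _ _) (hmix _ _) hαpos ?_
    rcases Nat.eq_zero_or_pos d₀ with h00 | h00
    · right; subst h00; simp [hx₀, mix]
    · left; exact wt_pos h00 hp.1 h₀.1
  have hl0 : Tendsto (fun l : ℝ => l) (𝓝[>] 0) (𝓝 0) := nhdsWithin_le_nhds
  -- At `l = 0` the required inequality between the two limits reduces to `ν < ν'`, so it persists
  -- for small `l > 0`. The parameters of the mixed type, which is interior, are then used at the
  -- original type.
  have hL : Tendsto (fun l : ℝ => (1 - l) * (ν + pairEntropy α x₀ x₁ x₂ - c)) (𝓝[>] 0)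
      (𝓝 (ν + pairEntropy α x₀ x₁ x₂ - c)) := by
    simpa using (hl0.const_sub 1).mul_const (ν + pairEntropy α x₀ x₁ x₂ - c)
  have hR := ((hent.const_add ν').sub_const c).sub (hl0.mul_const T)
  rw [zero_mul, sub_zero] at hR
  obtain ⟨l, hlt, hl⟩ := ((hL.eventually_lt hR (by linarith)).and
    (Ioo_mem_nhdsGT (zero_lt_one' ℝ))).exists
  obtain ⟨z₀, hz₀, e₀⟩ := exists_wt_eq_combo d₀ p h₀ hy ⟨hl.1, hl.2.le⟩
  obtain ⟨z₁, hz₁, e₁⟩ := exists_wt_eq_combo (d - d₀) p h₁ hy ⟨hl.1, hl.2.le⟩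
  obtain ⟨z₂, hz₂, e₂⟩ := exists_wt_eq_combo (d - d₀) p h₂ hy ⟨hl.1, hl.2.le⟩
  refine ⟨z₀, hz₀, z₁, hz₁, z₂, hz₂, ?_⟩
  have hcompat := H.combo H' hl.1.le hl.2.le
  have hA' := hA (mix α β l) z₀ z₁ z₂ ((admissible_iff hd hz₀ hz₁ hz₂).2 (by
    rw [e₀, e₁, e₂]; exact hcompat))
  rw [R₁_eq_pairExponent hd hp.1 hz₀ hz₁ hz₂, e₀, e₁, e₂, pairExponent] at hA'
  have t₀ := tilt_combo_le d₀ (x := x₀) hp.1 hy hz₀ hl.1.le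
  have t₁ := tilt_combo_le (d - d₀) (x := x₁) hp.1 hy hz₁ hl.1.le
  have t₂ := tilt_combo_le (d - d₀) (x := x₂) hp.1 hy hz₂ hl.1.le
  have hl' : 0 < 1 - l := by linarith [hl.2]
  simp only [mix] at hlt hA'
  have : (1 - l) * (ν + pairEntropy α x₀ x₁ x₂ - c)
      < (1 - l) * (tilt d₀ p x₀ z₀ + tilt (d - d₀) p x₁ z₁ + tilt (d - d₀) p x₂ z₂) := by
    rw [hT] at hlt
    linarith
  have := lt_of_mul_lt_mul_left this hl'.le
  rw [pairExponent]
  linarith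

/-- At each compatible type the chosen tilting parameters keep working nearby, in the type and in
`p'`, by continuity. Compactness of the parameter cube makes the neighbourhood of `p` uniform. -/
theorem eventually_pairExponent {d d₀ : ℕ} (hd : d₀ < d) {p : ℝ} (hp : p ∈ Ioo (0 : ℝ) 1)
    {ν ν' : ℝ} (hν : ν < ν')
    (hA : ∀ α y₀ y₁ y₂, Admissible d d₀ p α y₀ y₁ y₂ →
      ν' ≤ (2 * (d : ℝ) - d₀ - 1) * R₁ d d₀ p α y₀ y₁ y₂) :
    ∀ᶠ p' in 𝓝 p, ∀ v ∈ Icc (0 : ℝ) 1 ×ˢ (Icc (0 : ℝ) 1 ×ˢ (Icc (0 : ℝ) 1 ×ˢ Icc (0 : ℝ) 1)),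
      PairCompat v.1 (wt d₀ p' v.2.1) (wt (d - d₀) p' v.2.2.1) (wt (d - d₀) p' v.2.2.2) →
      ∃ y₀ ∈ Ioo (0 : ℝ) 1, ∃ y₁ ∈ Ioo (0 : ℝ) 1, ∃ y₂ ∈ Ioo (0 : ℝ) 1,
        ν < pairExponent d d₀ p' v.1 (wt d₀ p' v.2.1) (wt (d - d₀) p' v.2.2.1)
          (wt (d - d₀) p' v.2.2.2) y₀ y₁ y₂ := by
  have hK : IsCompact (Icc (0 : ℝ) 1 ×ˢ (Icc (0 : ℝ) 1 ×ˢ (Icc (0 : ℝ) 1 ×ˢ Icc (0 : ℝ) 1))) :=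
    isCompact_Icc.prod (isCompact_Icc.prod (isCompact_Icc.prod isCompact_Icc))
  refine hK.eventually_forall_of_forall_eventually fun v hv => ?_
  obtain ⟨α, a₀, a₁, a₂⟩ := v
  obtain ⟨hα, h₀, h₁, h₂⟩ := hv
  have c₀ : Continuous fun z : ℝ × ℝ × ℝ × ℝ × ℝ => wt d₀ z.1 z.2.2.1 := by unfold wt; fun_prop
  have c₁ : Continuous fun z : ℝ × ℝ × ℝ × ℝ × ℝ => wt (d - d₀) z.1 z.2.2.2.1 := by
    unfold wt; fun_prop
  have c₂ : Continuous fun z : ℝ × ℝ × ℝ × ℝ × ℝ => wt (d - d₀) z.1 z.2.2.2.2 := by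
    unfold wt; fun_prop
  have cα : Continuous fun z : ℝ × ℝ × ℝ × ℝ × ℝ => z.2.1 := by fun_prop
  by_cases H : PairCompat α (wt d₀ p a₀) (wt (d - d₀) p a₁) (wt (d - d₀) p a₂)
  · obtain ⟨y₀, hy₀, y₁, hy₁, y₂, hy₂, hlt⟩ := exists_lt_pairExponent hd hp hν hA h₀ h₁ h₂ H
    have hent := tendsto_pairEntropy (cα.tendsto (p, α, a₀, a₁, a₂)) (c₀.tendsto _) (c₁.tendsto _)
      (c₂.tendsto _) ((wt_pos (Nat.sub_pos_of_lt hd) hp.1 h₁.1).trans_le H.le₁)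
      (by
        rcases Nat.eq_zero_or_pos d₀ with h00 | h00
        · right; subst h00; simp
        · left; exact wt_pos h00 hp.1 h₀.1)
    have ct : ∀ {s : ℕ} {g : ℝ × ℝ × ℝ × ℝ × ℝ → ℝ} {y : ℝ}, Continuous g →
        Continuous fun z : ℝ × ℝ × ℝ × ℝ × ℝ => tilt s z.1 (g z) y := fun {s g y} hg =>
      (continuous_tilt s y).comp (continuous_fst.prodMk hg)
    have hc : Continuous fun z : ℝ × ℝ × ℝ × ℝ × ℝ => tilt d₀ z.1 (wt d₀ z.1 z.2.2.1) y₀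
        + tilt (d - d₀) z.1 (wt (d - d₀) z.1 z.2.2.2.1) y₁
        + tilt (d - d₀) z.1 (wt (d - d₀) z.1 z.2.2.2.2) y₂ + (2 * (d : ℝ) - d₀) * h z.1 :=
      (((ct c₀).add (ct c₁)).add (ct c₂)).add
        (continuous_const.mul (continuous_h.comp continuous_fst))
    filter_upwards [((hc.tendsto (p, α, a₀, a₁, a₂)).sub hent).eventually (lt_mem_nhds hlt)]
      with z hz _
    exact ⟨y₀, hy₀, y₁, hy₁, y₂, hy₂, hz⟩
  -- Compatibility is a closed condition, so near an incompatible type there is nothing to prove.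
  · have hclosed : IsClosed {z : ℝ × ℝ × ℝ × ℝ × ℝ | PairCompat z.2.1 (wt d₀ z.1 z.2.2.1)
        (wt (d - d₀) z.1 z.2.2.2.1) (wt (d - d₀) z.1 z.2.2.2.2)} := by
      have : {z : ℝ × ℝ × ℝ × ℝ × ℝ | PairCompat z.2.1 (wt d₀ z.1 z.2.2.1)
          (wt (d - d₀) z.1 z.2.2.2.1) (wt (d - d₀) z.1 z.2.2.2.2)}
          = {z | z.2.1 ≤ 1} ∩ ({z | wt d₀ z.1 z.2.2.1 ≤ z.2.1} ∩
            ({z | wt (d - d₀) z.1 z.2.2.2.1 ≤ z.2.1} ∩ ({z | wt (d - d₀) z.1 z.2.2.2.2 ≤ z.2.1} ∩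
            ({z | z.2.1 - wt d₀ z.1 z.2.2.1 ≤ wt (d - d₀) z.1 z.2.2.2.1} ∩
            {z | z.2.1 - wt d₀ z.1 z.2.2.1 ≤ wt (d - d₀) z.1 z.2.2.2.2})))) := by
        ext z
        exact ⟨fun ⟨h1, h2, h3, h4, h5, h6⟩ => ⟨h1, h2, h3, h4, h5, h6⟩,
          fun ⟨h1, h2, h3, h4, h5, h6⟩ => ⟨h1, h2, h3, h4, h5, h6⟩⟩
      rw [this]
      exact (isClosed_le cα continuous_const).inter ((isClosed_le c₀ cα).inter
        ((isClosed_le c₁ cα).inter ((isClosed_le c₂ cα).inter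
        ((isClosed_le (cα.sub c₀) c₁).inter (isClosed_le (cα.sub c₀) c₂)))))
    filter_upwards [hclosed.isOpen_compl.mem_nhds (show (p, α, a₀, a₁, a₂) ∈ _ from H)]
      with z hz hz'
    exact absurd hz' hz

/-- The mixing argument of `exists_lt_pairExponent` with a single weight, and `h x + x * h (p / x)`
in place of `pairEntropy`. -/
theorem exists_lt_disjExponent {s : ℕ} (hs : 1 ≤ s) {p : ℝ} (hp : p ∈ Ioo (0 : ℝ) 1)
    {ν ν' : ℝ} (hν : ν < ν')
    (hA : ∀ y ∈ Ioo (0 : ℝ) 1, q s p y ≤ 1 → ν' ≤ A s p y + h p - q s p y * h (p / q s p y))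
    {a : ℝ} (ha : a ∈ Icc (0 : ℝ) 1) (H : wt s p a ≤ 1) :
    ∃ y ∈ Ioo (0 : ℝ) 1, ν < disjExponent s p (wt s p a) y := by
  obtain ⟨y, h1, hy⟩ := ((exists_wt_le_one s hp).and (Ioo_mem_nhdsGT (zero_lt_one' ℝ))).exists
  set x := wt s p a with hx
  set c := ((s : ℝ) + 1) * h p with hc
  set T := tilt s p (wt s p y) y with hT
  have hxpos : 0 < x := wt_pos hs hp.1 ha.1
  have hl0 : Tendsto (fun l : ℝ => l) (𝓝[>] 0) (𝓝 0) := nhdsWithin_le_nhds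
  have hmix : Tendsto (fun l : ℝ => (1 - l) * x + l * wt s p y) (𝓝[>] 0) (𝓝 x) := by
    simpa using ((hl0.const_sub 1).mul_const x).add (hl0.mul_const (wt s p y))
  have hent := ((continuous_h.tendsto _).comp hmix).add
    (hmix.mul ((continuous_h.tendsto _).comp ((tendsto_const_nhds (x := p)).div hmix hxpos.ne')))
  have hL : Tendsto (fun l : ℝ => (1 - l) * (ν + (h x + x * h (p / x)) - c)) (𝓝[>] 0)
      (𝓝 (ν + (h x + x * h (p / x)) - c)) := by
    simpa using (hl0.const_sub 1).mul_const (ν + (h x + x * h (p / x)) - c)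
  have hR := ((hent.const_add ν').sub_const c).sub (hl0.mul_const T)
  rw [zero_mul, sub_zero] at hR
  obtain ⟨l, hlt, hl⟩ := ((hL.eventually_lt hR (by linarith)).and
    (Ioo_mem_nhdsGT (zero_lt_one' ℝ))).exists
  obtain ⟨z, hz, e⟩ := exists_wt_eq_combo s p ha hy ⟨hl.1, hl.2.le⟩
  refine ⟨z, hz, ?_⟩
  have hl' : 0 < 1 - l := by linarith [hl.2]
  have hA' := hA z hz (by
    rw [q_eq_wt _ _ hz.2, e]
    have := mul_le_mul_of_nonneg_left H hl'.le
    have := mul_le_mul_of_nonneg_left h1 hl.1.le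
    linarith)
  rw [disjExponent_eq hp.1 hz, e, disjExponent] at hA'
  rw [← hx] at hA'
  have t := tilt_combo_le s (x := x) hp.1 hy hz hl.1.le
  simp only [Function.comp_apply, Pi.div_apply] at hlt
  have : (1 - l) * (ν + (h x + x * h (p / x)) - c) < (1 - l) * tilt s p x z := by
    rw [hT] at hlt
    linarith
  have := lt_of_mul_lt_mul_left this hl'.le
  rw [disjExponent]
  linarith

theorem eventually_disjExponent {s : ℕ} (hs : 1 ≤ s) {p : ℝ} (hp : p ∈ Ioo (0 : ℝ) 1)
    {ν ν' : ℝ} (hν : ν < ν')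
    (hA : ∀ y ∈ Ioo (0 : ℝ) 1, q s p y ≤ 1 → ν' ≤ A s p y + h p - q s p y * h (p / q s p y)) :
    ∀ᶠ p' in 𝓝 p, ∀ a ∈ Icc (0 : ℝ) 1, wt s p' a ≤ 1 →
      ∃ y ∈ Ioo (0 : ℝ) 1, ν < disjExponent s p' (wt s p' a) y := by
  refine (isCompact_Icc (a := (0 : ℝ)) (b := 1)).eventually_forall_of_forall_eventually
    fun a ha => ?_
  have c := continuous_wt s
  by_cases H : wt s p a ≤ 1
  · obtain ⟨y, hy, hlt⟩ := exists_lt_disjExponent hs hp hν hA ha H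
    have t := c.tendsto (p, a)
    have hd : Tendsto (fun z : ℝ × ℝ => disjExponent s z.1 (wt s z.1 z.2) y) (𝓝 (p, a))
        (𝓝 (disjExponent s p (wt s p a) y)) := by
      have tp : Tendsto (fun z : ℝ × ℝ => z.1) (𝓝 (p, a)) (𝓝 p) := continuous_fst.tendsto _
      have ct := ((continuous_tilt s y).comp (continuous_fst.prodMk c)).tendsto (p, a)
      exact (((ct.add (((continuous_h.tendsto _).comp tp).const_mul ((s : ℝ) + 1))).sub
        ((continuous_h.tendsto _).comp t)).sub (t.mul ((continuous_h.tendsto _).comp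
          (tp.div t (wt_pos hs hp.1 ha.1).ne'))))
    filter_upwards [hd.eventually (lt_mem_nhds hlt)] with z hz _
    exact ⟨y, hy, hz⟩
  · filter_upwards [(c.tendsto (p, a)).eventually (lt_mem_nhds (not_le.1 H))] with z hz hz'
    exact absurd hz' (not_le.2 hz)

/-! ### Counting families of columns by their Boolean sums -/

/-- The columns of length `t` and weight `w`, as sets of rows. -/
abbrev ConstWt (t w : ℕ) := {S : Finset (Fin t) // S.card = w}

theorem card_constWt (t w : ℕ) : Fintype.card (ConstWt t w) = t.choose w := by
  simp

/-- The Boolean sum of a family of columns. -/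
def unionOf {κ : Type*} [Fintype κ] {t w : ℕ} (x : κ → ConstWt t w) : Finset (Fin t) :=
  Finset.univ.biUnion fun i => (x i).1

theorem mem_unionOf {κ : Type*} [Fintype κ] {t w : ℕ} {x : κ → ConstWt t w} {j : Fin t} :
    j ∈ unionOf x ↔ ∃ i, j ∈ (x i).1 := by
  simp [unionOf]

theorem card_unionOf_le {s t w : ℕ} (x : Fin s → ConstWt t w) : (unionOf x).card ≤ s * w := by
  refine Finset.card_biUnion_le.trans ?_
  simp [fun i => (x i).2]

/-- The families of `s` columns with a given Boolean sum. -/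
def unionFiber (s : ℕ) {t : ℕ} (w : ℕ) (U : Finset (Fin t)) : Finset (Fin s → ConstWt t w) :=
  Finset.univ.filter fun x => unionOf x = U

theorem mem_unionFiber {s t w : ℕ} {U : Finset (Fin t)} {x : Fin s → ConstWt t w} :
    x ∈ unionFiber s w U ↔ unionOf x = U := by simp [unionFiber]

/-- Read a family row by row: row `j` gives the set of indices of the columns containing `j`,
nonempty exactly when `j ∈ U`. Every family in the fibre has total weight `z ^ (s * w)`. Dropping
the constraint on column weights lets the sum factor over rows, each row of `U` contributing `(1 +
z) ^ s - 1`. -/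
theorem card_unionFiber_mul_pow_le (s : ℕ) {t : ℕ} (w : ℕ) (U : Finset (Fin t)) {z : ℝ}
    (hz : 0 < z) :
    ((unionFiber s w U).card : ℝ) * z ^ (s * w) ≤ ((1 + z) ^ s - 1) ^ U.card := by
  classical
  let T : Fin t → Finset (Finset (Fin s)) := fun j => if j ∈ U then Finset.univ.erase ∅ else {∅}
  let F : (Fin s → ConstWt t w) → Fin t → Finset (Fin s) :=
    fun x j => Finset.univ.filter fun i => j ∈ (x i).1
  have hsum : ∑ V : Finset (Fin s), z ^ V.card = (1 + z) ^ s := by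
    have := Finset.prod_one_add (f := fun _ : Fin s => z) (s := Finset.univ)
    simpa using this.symm
  have h1 : ∏ j, ∑ V ∈ T j, z ^ V.card = ((1 + z) ^ s - 1) ^ U.card := by
    have : ∀ j, ∑ V ∈ T j, z ^ V.card = if j ∈ U then (1 + z) ^ s - 1 else 1 := fun j => by
      by_cases hj : j ∈ U
      · simp only [T, hj, if_true]
        rw [← hsum, ← Finset.add_sum_erase _ _ (Finset.mem_univ ∅)]
        simp
      · simp [T, hj]
    simp only [this, Finset.prod_ite_mem, Finset.univ_inter, Finset.prod_const]
  rw [← h1, Finset.prod_univ_sum]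
  have hinj : Function.Injective F := fun x x' hx => by
    funext i
    ext j
    have := congrArg (i ∈ ·) (congrFun hx j)
    simpa [F] using this
  have hprod : ∀ x : Fin s → ConstWt t w, ∏ j, z ^ (F x j).card = z ^ (s * w) := fun x => by
    rw [Finset.prod_pow_eq_pow_sum]
    congr 1
    simp only [F, Finset.card_filter]
    rw [Finset.sum_comm]
    simp [fun i => (x i).2]
  calc ((unionFiber s w U).card : ℝ) * z ^ (s * w)
      = ∑ x ∈ unionFiber s w U, ∏ j, z ^ (F x j).card := by simp [hprod]
    _ = ∑ f ∈ (unionFiber s w U).image F, ∏ j, z ^ (f j).card := by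
        rw [Finset.sum_image hinj.injOn]
    _ ≤ _ := by
        refine Finset.sum_le_sum_of_subset_of_nonneg ?_ fun _ _ _ => by positivity
        intro f hf
        obtain ⟨x, hx, rfl⟩ := Finset.mem_image.1 hf
        rw [mem_unionFiber] at hx
        rw [Fintype.mem_piFinset]
        intro j
        by_cases hj : j ∈ U
        · simp only [T, hj, if_true, Finset.mem_erase, Finset.mem_univ, and_true]
          rw [← hx, mem_unionOf] at hj
          obtain ⟨i, hi⟩ := hj
          exact Finset.ne_empty_of_mem (a := i) (by simp [F, hi])
        · simp only [T, hj, if_false, Finset.mem_singleton]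
          rw [← hx, mem_unionOf] at hj
          push Not at hj
          simp [F, hj]

/-- The generating function bound at `z = (1 - y) / y`, for which `(1 + z) ^ s - 1 = (1 - y ^ s) / y
^ s`. -/
theorem card_unionFiber_le (s : ℕ) {t : ℕ} (ht : 0 < t) (w : ℕ) (U : Finset (Fin t)) {y : ℝ}
    (hy : y ∈ Ioo (0 : ℝ) 1) :
    ((unionFiber s w U).card : ℝ)
      ≤ (2 : ℝ) ^ (-((t : ℝ) * tilt s ((w : ℝ) / t) ((U.card : ℝ) / t) y)) := by
  have ht' : (t : ℝ) ≠ 0 := by exact_mod_cast ht.ne'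
  have h2 : 0 < 1 - y := by linarith [hy.2]
  have hz : 0 < (1 - y) / y := div_pos h2 hy.1
  have key := card_unionFiber_mul_pow_le s w U hz
  have e1 : (1 + (1 - y) / y) ^ s - 1 = (1 - y ^ s) / y ^ s := by
    have := hy.1.ne'
    rw [one_add_div this, add_sub_cancel, div_pow, one_pow]
    field_simp
  have e2 : -((t : ℝ) * tilt s ((w : ℝ) / t) ((U.card : ℝ) / t) y)
      = (U.card : ℝ) * Real.logb 2 ((1 - y ^ s) / y ^ s)
        + -(((s * w : ℕ) : ℝ) * Real.logb 2 ((1 - y) / y)) := by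
    unfold tilt
    push_cast
    field_simp
    ring
  rw [e1] at key
  rw [e2, Real.rpow_add (by norm_num), Real.rpow_neg (by norm_num), ← pow_eq_two_rpow hz,
    ← div_eq_mul_inv, le_div_iff₀ (by positivity)]
  -- For `s = 0` the logarithm of `(1 - y ^ s) / y ^ s = 0` takes its default value; the only family
  -- has empty Boolean sum, and other fibres are empty.
  rcases Nat.eq_zero_or_pos s with rfl | hs
  · rcases Nat.eq_zero_or_pos U.card with h0 | h0
    · rw [h0] at key ⊢
      simpa using key
    · rw [pow_zero, sub_self, zero_div, zero_pow h0.ne'] at key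
      exact key.trans (by positivity)
  · have : 0 < 1 - y ^ s := by
      have := pow_lt_one₀ hy.1.le hy.2 (Nat.pos_iff_ne_zero.1 hs)
      linarith
    rwa [← pow_eq_two_rpow (div_pos this (pow_pos hy.1 s))]

/-- The relative weight of the Boolean sum lies between those at `a = 0` (one column) and `a = 1`
(disjoint columns). The endpoints do occur, hence the closed interval. -/
theorem exists_wt_eq_card {s t w : ℕ} (x : Fin s → ConstWt t w) :
    ∃ a ∈ Icc (0 : ℝ) 1, ((unionOf x).card : ℝ) / t = wt s ((w : ℝ) / t) a := by
  rcases Nat.eq_zero_or_pos s with rfl | hs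
  · exact ⟨0, ⟨le_rfl, zero_le_one⟩, by simp [unionOf]⟩
  have h1 : wt s ((w : ℝ) / t) 0 ≤ ((unionOf x).card : ℝ) / t := by
    rw [wt_zero_right hs]
    gcongr
    refine (x ⟨0, hs⟩).2.symm.le.trans ?_
    exact Finset.card_le_card fun j hj => mem_unionOf.2 ⟨_, hj⟩
  have h2 : ((unionOf x).card : ℝ) / t ≤ wt s ((w : ℝ) / t) 1 := by
    rw [wt_one_right, div_mul_eq_mul_div]
    gcongr
    rw [mul_comm]
    exact_mod_cast card_unionOf_le x
  obtain ⟨a, ha, e⟩ := intermediate_value_Icc (zero_le_one' ℝ)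
    (continuous_wt_right s ((w : ℝ) / t)).continuousOn ⟨h1, h2⟩
  exact ⟨a, ha, e.symm⟩

/-- `U₁` consists of `U \ U₀` and of `U₁ ∩ U₀`, likewise `U₂`. So a quadruple is given by `U`, by
`U₀` inside it, and by two subsets of `U₀`; each choice accounts for one entropy term, bounded by an
inverse binomial. -/
theorem two_rpow_neg_pairEntropy_le {t : ℕ} (ht : 0 < t) {U U₀ U₁ U₂ : Finset (Fin t)}
    (h₁ : U₀ ∪ U₁ = U) (h₂ : U₀ ∪ U₂ = U) :
    (2 : ℝ) ^ (-((t : ℝ) * pairEntropy ((U.card : ℝ) / t) ((U₀.card : ℝ) / t) ((U₁.card : ℝ) / t)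
        ((U₂.card : ℝ) / t)))
      ≤ ((t.choose U.card : ℝ))⁻¹ * (((U.card.choose U₀.card : ℝ))⁻¹ *
        (((U₀.card.choose (U₁ ∩ U₀).card : ℝ))⁻¹ * ((U₀.card.choose (U₂ ∩ U₀).card : ℝ))⁻¹)) := by
  have ht' : (t : ℝ) ≠ 0 := by exact_mod_cast ht.ne'
  have aux : ∀ V : Finset (Fin t), U₀ ∪ V = U →
      ((V.card : ℝ) / t + (U₀.card : ℝ) / t - (U.card : ℝ) / t) / ((U₀.card : ℝ) / t)
        = ((V ∩ U₀).card : ℝ) / U₀.card := fun V hV => by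
    have := Finset.card_union_add_card_inter U₀ V
    rw [hV, Finset.inter_comm] at this
    have : (U.card : ℝ) + (V ∩ U₀).card = U₀.card + V.card := by exact_mod_cast this
    rw [← add_div, ← sub_div, div_div_div_cancel_right₀ ht']
    congr 1
    linarith
  have e : -((t : ℝ) * pairEntropy ((U.card : ℝ) / t) ((U₀.card : ℝ) / t) ((U₁.card : ℝ) / t)
        ((U₂.card : ℝ) / t))
      = -((t : ℝ) * h ((U.card : ℝ) / t)) + (-((U.card : ℝ) * h ((U₀.card : ℝ) / U.card))
        + (-((U₀.card : ℝ) * h (((U₁ ∩ U₀).card : ℝ) / U₀.card))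
        + -((U₀.card : ℝ) * h (((U₂ ∩ U₀).card : ℝ) / U₀.card)))) := by
    rw [pairEntropy, aux U₁ h₁, aux U₂ h₂, div_div_div_cancel_right₀ ht']
    field_simp
    ring
  rw [e, Real.rpow_add (by norm_num), Real.rpow_add (by norm_num), Real.rpow_add (by norm_num)]
  have b0 : U.card ≤ t := by simpa using Finset.card_le_univ U
  have b1 : U₀.card ≤ U.card := Finset.card_le_card (h₁ ▸ Finset.subset_union_left)
  have b2 : (U₁ ∩ U₀).card ≤ U₀.card := Finset.card_le_card Finset.inter_subset_right
  have b3 : (U₂ ∩ U₀).card ≤ U₀.card := Finset.card_le_card Finset.inter_subset_right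
  gcongr <;> exact two_rpow_neg_le_inv_choose ‹_›

/-- Outside `U₀` the set `V` must agree with `U`, so it is determined by `V ∩ U₀`. -/
theorem sum_union_eq_le {t : ℕ} (U U₀ : Finset (Fin t)) :
    ∑ V ∈ Finset.univ.filter (fun V => U₀ ∪ V = U), ((U₀.card.choose (V ∩ U₀).card : ℝ))⁻¹
      ≤ (t : ℝ) + 1 := by
  have hinj : Set.InjOn (fun V => V ∩ U₀)
      (Finset.univ.filter (fun V => U₀ ∪ V = U) : Finset (Finset (Fin t))) := by
    intro V hV V' hV' e
    simp only [Finset.coe_filter, Finset.mem_univ, true_and, Set.mem_ofPred_eq] at hV hV'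
    ext j
    have e1 := congrArg (j ∈ ·) (hV.trans hV'.symm)
    have e2 := congrArg (j ∈ ·) e
    simp only [Finset.mem_union, Finset.mem_inter, eq_iff_iff] at e1 e2
    tauto
  calc _ = ∑ W ∈ (Finset.univ.filter (fun V => U₀ ∪ V = U)).image (fun V => V ∩ U₀),
        ((U₀.card.choose W.card : ℝ))⁻¹ := by rw [Finset.sum_image hinj]
    _ ≤ ∑ W ∈ U₀.powerset, ((U₀.card.choose W.card : ℝ))⁻¹ := by
        refine Finset.sum_le_sum_of_subset_of_nonneg ?_ fun _ _ _ => by positivity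
        intro W hW
        obtain ⟨V, -, rfl⟩ := Finset.mem_image.1 hW
        exact Finset.mem_powerset.2 Finset.inter_subset_right
    _ = U₀.card + 1 := sum_powerset_inv_choose U₀
    _ ≤ _ := by
        have : U₀.card ≤ t := by simpa using Finset.card_le_univ U₀
        gcongr

theorem sum_inv_choose_univ (t : ℕ) :
    ∑ U : Finset (Fin t), ((t.choose U.card : ℝ))⁻¹ = (t : ℝ) + 1 := by
  have := sum_powerset_inv_choose (Finset.univ : Finset (Fin t))
  simpa using this

theorem sum_sigma_inv_choose_le (t : ℕ) :
    ∑ τ ∈ (Finset.univ : Finset (Finset (Fin t))).sigma fun U => U.powerset.sigma fun U₀ =>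
        (Finset.univ.filter fun V => U₀ ∪ V = U) ×ˢ (Finset.univ.filter fun V => U₀ ∪ V = U),
      ((t.choose τ.1.card : ℝ))⁻¹ * (((τ.1.card.choose τ.2.1.card : ℝ))⁻¹ *
        (((τ.2.1.card.choose (τ.2.2.1 ∩ τ.2.1).card : ℝ))⁻¹ *
          ((τ.2.1.card.choose (τ.2.2.2 ∩ τ.2.1).card : ℝ))⁻¹)) ≤ ((t : ℝ) + 1) ^ 4 := by
  rw [Finset.sum_sigma]
  simp only [Finset.sum_sigma, Finset.sum_product, ← Finset.mul_sum, ← Finset.sum_mul]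
  calc _ ≤ ∑ U : Finset (Fin t), ((t.choose U.card : ℝ))⁻¹ * (((t : ℝ) + 1) *
        (((t : ℝ) + 1) * ((t : ℝ) + 1))) := by
        refine Finset.sum_le_sum fun U _ => mul_le_mul_of_nonneg_left ?_ (by positivity)
        calc _ ≤ ∑ U₀ ∈ U.powerset, ((U.card.choose U₀.card : ℝ))⁻¹ *
              (((t : ℝ) + 1) * ((t : ℝ) + 1)) := by
              refine Finset.sum_le_sum fun U₀ _ => mul_le_mul_of_nonneg_left ?_ (by positivity)
              exact mul_le_mul (sum_union_eq_le U U₀) (sum_union_eq_le U U₀)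
                (Finset.sum_nonneg fun _ _ => by positivity) (by positivity)
          _ ≤ _ := by
              rw [← Finset.sum_mul, sum_powerset_inv_choose]
              have : U.card ≤ t := by simpa using Finset.card_le_univ U
              gcongr
    _ = _ := by rw [← Finset.sum_mul, sum_inv_choose_univ]; ring

/-! ### The number of bad families -/

/-- The families of `a + b + b` columns for which the first `a` columns with the next `b` ones, and
with the last `b` ones, have the same Boolean sum. -/
def pairBad (t w a b : ℕ) : Finset (Fin a ⊕ (Fin b ⊕ Fin b) → ConstWt t w) :=
  Finset.univ.filter fun x =>
    unionOf (x ∘ Sum.inl) ∪ unionOf (x ∘ Sum.inr ∘ Sum.inl)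
      = unionOf (x ∘ Sum.inl) ∪ unionOf (x ∘ Sum.inr ∘ Sum.inr)

/-- The families of `s + m` columns for which the Boolean sum of the first `s` ones covers the
others. -/
def coverBad (t w s m : ℕ) : Finset (Fin s ⊕ Fin m → ConstWt t w) :=
  Finset.univ.filter fun x => ∀ i, (x (Sum.inr i)).1 ⊆ unionOf (x ∘ Sum.inl)

theorem mem_pairBad {t w a b : ℕ} {x : Fin a ⊕ (Fin b ⊕ Fin b) → ConstWt t w} :
    x ∈ pairBad t w a b ↔
      unionOf (x ∘ Sum.inl) ∪ unionOf (x ∘ Sum.inr ∘ Sum.inl)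
        = unionOf (x ∘ Sum.inl) ∪ unionOf (x ∘ Sum.inr ∘ Sum.inr) := by
  simp [pairBad]

theorem mem_coverBad {t w s m : ℕ} {x : Fin s ⊕ Fin m → ConstWt t w} :
    x ∈ coverBad t w s m ↔ ∀ i, (x (Sum.inr i)).1 ⊆ unionOf (x ∘ Sum.inl) := by
  simp [coverBad]

theorem card_inv_mem_Icc {t : ℕ} (U : Finset (Fin t)) : (U.card : ℝ) / t ∈ Icc (0 : ℝ) 1 := by
  have : U.card ≤ t := by simpa using Finset.card_le_univ U
  exact ⟨by positivity, div_le_one_of_le₀ (by exact_mod_cast this) (by positivity)⟩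

theorem two_rpow_mul_h_le_card {t w : ℕ} (hw : w ≤ t) (r : ℕ) :
    (2 : ℝ) ^ ((t : ℝ) * (r * h ((w : ℝ) / t)))
      ≤ ((t : ℝ) + 1) ^ r * (Fintype.card (ConstWt t w) : ℝ) ^ r := by
  rw [card_constWt, ← mul_pow, show (t : ℝ) * (r * h ((w : ℝ) / t)) = (t * h ((w : ℝ) / t)) * r by ring,
    Real.rpow_mul (by norm_num), Real.rpow_natCast]
  exact pow_le_pow_left₀ (by positivity) (two_rpow_le_choose hw) r

theorem pairCompat_card {t : ℕ} (ht : 0 < t) {U U₀ U₁ U₂ : Finset (Fin t)}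
    (h₁ : U₀ ∪ U₁ = U) (h₂ : U₀ ∪ U₂ = U) :
    PairCompat ((U.card : ℝ) / t) ((U₀.card : ℝ) / t) ((U₁.card : ℝ) / t) ((U₂.card : ℝ) / t) := by
  have ht' : (0 : ℝ) < t := by exact_mod_cast ht
  have c : ∀ {V W : Finset (Fin t)}, V ⊆ W → (V.card : ℝ) / t ≤ (W.card : ℝ) / t := fun hVW => by
    have := Finset.card_le_card hVW
    gcongr
  have u : ∀ V, U₀ ∪ V = U → (U.card : ℝ) / t - (U₀.card : ℝ) / t ≤ (V.card : ℝ) / t :=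
    fun V hV => by
      rw [sub_le_iff_le_add', ← add_div]
      gcongr
      rw [← hV]
      exact_mod_cast Finset.card_union_le _ _
  exact ⟨(card_inv_mem_Icc U).2, c (h₁ ▸ Finset.subset_union_left),
    c (h₁ ▸ Finset.subset_union_right), c (h₂ ▸ Finset.subset_union_right), u _ h₁, u _ h₂⟩

/-- Bad families are split by the quadruple of their Boolean sums. Each class is bounded by a
product of three fibres with tilting parameters adapted to its type, and the factor `2 ^ (t *
pairEntropy)` lost there is recovered as inverse binomials, whose sum over all quadruples is
polynomial in `t`. -/
theorem card_pairBad_le {t w d d₀ : ℕ} (ht : 0 < t) (hw : w ≤ t) (hd : d₀ < d) {ν : ℝ}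
    (hE : ∀ v ∈ Icc (0 : ℝ) 1 ×ˢ (Icc (0 : ℝ) 1 ×ˢ (Icc (0 : ℝ) 1 ×ˢ Icc (0 : ℝ) 1)),
      PairCompat v.1 (wt d₀ ((w : ℝ) / t) v.2.1) (wt (d - d₀) ((w : ℝ) / t) v.2.2.1)
        (wt (d - d₀) ((w : ℝ) / t) v.2.2.2) →
      ∃ y₀ ∈ Ioo (0 : ℝ) 1, ∃ y₁ ∈ Ioo (0 : ℝ) 1, ∃ y₂ ∈ Ioo (0 : ℝ) 1,
        ν < pairExponent d d₀ ((w : ℝ) / t) v.1 (wt d₀ ((w : ℝ) / t) v.2.1)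
          (wt (d - d₀) ((w : ℝ) / t) v.2.2.1) (wt (d - d₀) ((w : ℝ) / t) v.2.2.2) y₀ y₁ y₂) :
    ((pairBad t w d₀ (d - d₀)).card : ℝ)
      ≤ ((t : ℝ) + 1) ^ (4 + (d₀ + ((d - d₀) + (d - d₀)))) * (2 : ℝ) ^ (-((t : ℝ) * ν)) *
        (Fintype.card (ConstWt t w) : ℝ) ^ (d₀ + ((d - d₀) + (d - d₀))) := by
  classical
  set r := d₀ + ((d - d₀) + (d - d₀)) with hr
  have hrr : (r : ℝ) = 2 * d - d₀ := by
    rw [hr]; push_cast [Nat.cast_sub hd.le]; ring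
  have ht' : (0 : ℝ) < t := by exact_mod_cast ht
  let T := (Finset.univ : Finset (Finset (Fin t))).sigma fun U => U.powerset.sigma fun U₀ =>
        (Finset.univ.filter fun V => U₀ ∪ V = U) ×ˢ (Finset.univ.filter fun V => U₀ ∪ V = U)
  let F : (Fin d₀ ⊕ (Fin (d - d₀) ⊕ Fin (d - d₀)) → ConstWt t w) →
      (Σ _ : Finset (Fin t), Σ _ : Finset (Fin t), Finset (Fin t) × Finset (Fin t)) := fun x =>
    ⟨unionOf (x ∘ Sum.inl) ∪ unionOf (x ∘ Sum.inr ∘ Sum.inl), unionOf (x ∘ Sum.inl),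
      unionOf (x ∘ Sum.inr ∘ Sum.inl), unionOf (x ∘ Sum.inr ∘ Sum.inr)⟩
  have hF : ∀ x ∈ pairBad t w d₀ (d - d₀), F x ∈ T := fun x hx => by
    have hx' := mem_pairBad.1 hx
    simp only [T, F, Finset.mem_sigma, Finset.mem_univ, Finset.mem_powerset, Finset.mem_product,
      Finset.mem_filter, true_and]
    exact ⟨Finset.subset_union_left, hx'.symm⟩
  rw [Finset.card_eq_sum_card_fiberwise hF]
  push_cast
  have hbound : ∀ τ ∈ T, (((pairBad t w d₀ (d - d₀)).filter fun x => F x = τ).card : ℝ)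
      ≤ (2 : ℝ) ^ (-((t : ℝ) * ν)) * (2 : ℝ) ^ ((t : ℝ) * (r * h ((w : ℝ) / t))) *
        (((t.choose τ.1.card : ℝ))⁻¹ * (((τ.1.card.choose τ.2.1.card : ℝ))⁻¹ *
        (((τ.2.1.card.choose (τ.2.2.1 ∩ τ.2.1).card : ℝ))⁻¹ *
          ((τ.2.1.card.choose (τ.2.2.2 ∩ τ.2.1).card : ℝ))⁻¹))) := by
    rintro ⟨U, U₀, U₁, U₂⟩ hτ
    simp only [T, Finset.mem_sigma, Finset.mem_univ, Finset.mem_powerset, Finset.mem_product,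
      Finset.mem_filter, true_and] at hτ
    obtain ⟨-, h₁, h₂⟩ := hτ
    -- A member of the class is needed to know that the three weights lie in the range of `wt`,
    -- where the hypothesis applies.
    rcases Finset.eq_empty_or_nonempty ((pairBad t w d₀ (d - d₀)).filter
      fun x => F x = ⟨U, U₀, U₁, U₂⟩) with h0 | ⟨x, hx⟩
    · rw [h0]; simp only [Finset.card_empty, Nat.cast_zero]; positivity
    have hdata : ∀ x, F x = ⟨U, U₀, U₁, U₂⟩ → unionOf (x ∘ Sum.inl) = U₀ ∧
        unionOf (x ∘ Sum.inr ∘ Sum.inl) = U₁ ∧ unionOf (x ∘ Sum.inr ∘ Sum.inr) = U₂ :=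
      fun x hx => by
        simp only [F, Sigma.mk.injEq, heq_eq_eq, Prod.mk.injEq] at hx
        exact hx.2
    have hcard : ((pairBad t w d₀ (d - d₀)).filter fun x => F x = ⟨U, U₀, U₁, U₂⟩).card
        ≤ (unionFiber d₀ w U₀).card *
          ((unionFiber (d - d₀) w U₁).card * (unionFiber (d - d₀) w U₂).card) := by
      rw [← Finset.card_product, ← Finset.card_product]
      refine Finset.card_le_card_of_injOn
        (fun x => (x ∘ Sum.inl, x ∘ Sum.inr ∘ Sum.inl, x ∘ Sum.inr ∘ Sum.inr)) ?_ ?_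
      · intro x hx
        obtain ⟨e0, e1, e2⟩ := hdata x (Finset.mem_filter.1 hx).2
        simp [mem_unionFiber, e0, e1, e2]
      · intro x _ x' _ e
        simp only [Prod.mk.injEq] at e
        obtain ⟨e0, e1, e2⟩ := e
        funext i
        rcases i with i | i | i
        exacts [congrFun e0 i, congrFun e1 i, congrFun e2 i]
    obtain ⟨e0, e1, e2⟩ := hdata x (Finset.mem_filter.1 hx).2
    obtain ⟨a₀, ha₀, w₀⟩ := exists_wt_eq_card (x ∘ Sum.inl)
    obtain ⟨a₁, ha₁, w₁⟩ := exists_wt_eq_card (x ∘ Sum.inr ∘ Sum.inl)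
    obtain ⟨a₂, ha₂, w₂⟩ := exists_wt_eq_card (x ∘ Sum.inr ∘ Sum.inr)
    rw [e0] at w₀
    rw [e1] at w₁
    rw [e2] at w₂
    obtain ⟨y₀, hy₀, y₁, hy₁, y₂, hy₂, hlt⟩ := hE ((U.card : ℝ) / t, a₀, a₁, a₂)
      ⟨card_inv_mem_Icc U, ha₀, ha₁, ha₂⟩ (by
        rw [← w₀, ← w₁, ← w₂]; exact pairCompat_card ht h₁ h₂)
    rw [← w₀, ← w₁, ← w₂, pairExponent, ← hrr] at hlt
    calc (((pairBad t w d₀ (d - d₀)).filter fun x => F x = ⟨U, U₀, U₁, U₂⟩).card : ℝ)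
        ≤ ((unionFiber d₀ w U₀).card : ℝ) *
          ((unionFiber (d - d₀) w U₁).card * (unionFiber (d - d₀) w U₂).card) := by
          exact_mod_cast hcard
      _ ≤ _ := mul_le_mul (card_unionFiber_le d₀ ht w U₀ hy₀) (mul_le_mul
          (card_unionFiber_le (d - d₀) ht w U₁ hy₁) (card_unionFiber_le (d - d₀) ht w U₂ hy₂)
          (by positivity) (by positivity)) (by positivity) (by positivity)
      _ ≤ (2 : ℝ) ^ (-((t : ℝ) * ν)) * (2 : ℝ) ^ ((t : ℝ) * (r * h ((w : ℝ) / t))) *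
          (2 : ℝ) ^ (-((t : ℝ) * pairEntropy ((U.card : ℝ) / t) ((U₀.card : ℝ) / t)
            ((U₁.card : ℝ) / t) ((U₂.card : ℝ) / t))) := by
          simp only [← Real.rpow_add (zero_lt_two' ℝ)]
          refine Real.rpow_le_rpow_of_exponent_le (by norm_num) ?_
          have := mul_le_mul_of_nonneg_left hlt.le ht'.le
          linarith
      _ ≤ _ := mul_le_mul_of_nonneg_left (two_rpow_neg_pairEntropy_le ht h₁ h₂) (by positivity)
  refine (Finset.sum_le_sum hbound).trans ?_
  rw [← Finset.mul_sum]
  calc _ ≤ (2 : ℝ) ^ (-((t : ℝ) * ν)) *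
        (((t : ℝ) + 1) ^ r * (Fintype.card (ConstWt t w) : ℝ) ^ r) * ((t : ℝ) + 1) ^ 4 := by
        gcongr
        · exact two_rpow_mul_h_le_card hw r
        · exact sum_sigma_inv_choose_le t
    _ = _ := by rw [pow_add]; ring

theorem card_coverBad_le_sum (t w s m : ℕ) :
    (coverBad t w s m).card
      ≤ ∑ U : Finset (Fin t), (unionFiber s w U).card * (U.card.choose w) ^ m := by
  classical
  rw [Finset.card_eq_sum_card_fiberwise (f := fun x => unionOf (x ∘ Sum.inl)) (t := Finset.univ)
    (fun _ _ => Finset.mem_coe.2 (Finset.mem_univ _))]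
  refine Finset.sum_le_sum fun U _ => ?_
  have hpi : (U.card.choose w) ^ m
      = (Fintype.piFinset fun _ : Fin m => U.powersetCard w).card := by
    simp [Fintype.card_piFinset]
  rw [hpi, ← Finset.card_product]
  refine Finset.card_le_card_of_injOn (fun x => (x ∘ Sum.inl, fun i => (x (Sum.inr i)).1)) ?_ ?_
  · intro x hx
    obtain ⟨h1, h2⟩ := Finset.mem_filter.1 hx
    have h3 := mem_coverBad.1 h1
    rw [h2] at h3
    simp only [Finset.coe_product, Set.mem_prod, Finset.mem_coe, mem_unionFiber,
      Fintype.mem_piFinset, Finset.mem_powersetCard]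
    exact ⟨h2, fun i => ⟨h3 i, (x (Sum.inr i)).2⟩⟩
  · intro x _ x' _ e
    simp only [Prod.mk.injEq] at e
    funext i
    rcases i with i | i
    · exact congrFun e.1 i
    · exact Subtype.ext (congrFun e.2 i)

theorem card_coverBad_one_le {t w s : ℕ} (ht : 0 < t) (hw : w ≤ t) (hs : 1 ≤ s) {ν : ℝ}
    (hE : ∀ a ∈ Icc (0 : ℝ) 1, wt s ((w : ℝ) / t) a ≤ 1 →
      ∃ y ∈ Ioo (0 : ℝ) 1, ν < disjExponent s ((w : ℝ) / t) (wt s ((w : ℝ) / t) a) y) :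
    ((coverBad t w s 1).card : ℝ)
      ≤ ((t : ℝ) + 1) ^ (1 + (s + 1)) * (2 : ℝ) ^ (-((t : ℝ) * ν)) *
        (Fintype.card (ConstWt t w) : ℝ) ^ (s + 1) := by
  have ht' : (0 : ℝ) < t := by exact_mod_cast ht
  have hbound : ∀ U : Finset (Fin t),
      ((unionFiber s w U).card : ℝ) * (U.card.choose w : ℝ) ^ 1
        ≤ (2 : ℝ) ^ (-((t : ℝ) * ν)) * (2 : ℝ) ^ ((t : ℝ) * ((s + 1 : ℕ) * h ((w : ℝ) / t))) *
          ((t.choose U.card : ℝ))⁻¹ := fun U => by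
    rcases Finset.eq_empty_or_nonempty (unionFiber s w U) with h0 | ⟨x, hx⟩
    · rw [h0]; simp only [Finset.card_empty, Nat.cast_zero, zero_mul]; positivity
    rw [mem_unionFiber] at hx
    obtain ⟨a, ha, e⟩ := exists_wt_eq_card x
    rw [hx] at e
    obtain ⟨y, hy, hlt⟩ := hE a ha (e ▸ (card_inv_mem_Icc U).2)
    rw [← e, disjExponent, div_div_div_cancel_right₀ ht'.ne'] at hlt
    have hwU : w ≤ U.card := by
      refine (x ⟨0, hs⟩).2.symm.le.trans ?_
      rw [← hx]
      exact Finset.card_le_card fun j hj => mem_unionOf.2 ⟨_, hj⟩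
    have hUt : U.card ≤ t := by simpa using Finset.card_le_univ U
    rw [pow_one]
    calc ((unionFiber s w U).card : ℝ) * (U.card.choose w : ℝ)
        ≤ (2 : ℝ) ^ (-((t : ℝ) * tilt s ((w : ℝ) / t) ((U.card : ℝ) / t) y)) *
          (U.card.choose w : ℝ) := by
          gcongr; exact card_unionFiber_le s ht w U hy
      _ ≤ (2 : ℝ) ^ (-((t : ℝ) * ν)) * (2 : ℝ) ^ ((t : ℝ) * ((s + 1 : ℕ) * h ((w : ℝ) / t))) *
          ((2 : ℝ) ^ (-((t : ℝ) * h ((U.card : ℝ) / t))) *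
          (2 : ℝ) ^ (-((U.card : ℝ) * h ((w : ℝ) / U.card)))) * (U.card.choose w : ℝ) := by
          gcongr
          simp only [← Real.rpow_add (zero_lt_two' ℝ)]
          refine Real.rpow_le_rpow_of_exponent_le (by norm_num) ?_
          have := mul_le_mul_of_nonneg_left hlt.le ht'.le
          have e2 : (t : ℝ) * ((U.card : ℝ) / t * h ((w : ℝ) / U.card))
              = (U.card : ℝ) * h ((w : ℝ) / U.card) := by
            field_simp
          push_cast
          linarith
      _ ≤ (2 : ℝ) ^ (-((t : ℝ) * ν)) * (2 : ℝ) ^ ((t : ℝ) * ((s + 1 : ℕ) * h ((w : ℝ) / t))) *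
          (2 : ℝ) ^ (-((t : ℝ) * h ((U.card : ℝ) / t))) := by
          have := choose_mul_two_rpow_le hwU
          rw [← mul_assoc, mul_assoc _ _ (U.card.choose w : ℝ)]
          refine mul_le_of_le_one_right (by positivity) ?_
          rw [mul_comm]; exact this
      _ ≤ _ := mul_le_mul_of_nonneg_left (two_rpow_neg_le_inv_choose hUt) (by positivity)
  calc ((coverBad t w s 1).card : ℝ)
      ≤ ∑ U : Finset (Fin t), ((unionFiber s w U).card : ℝ) * (U.card.choose w : ℝ) ^ 1 := by
        exact_mod_cast card_coverBad_le_sum t w s 1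
    _ ≤ _ := Finset.sum_le_sum fun U _ => hbound U
    _ = (2 : ℝ) ^ (-((t : ℝ) * ν)) * (2 : ℝ) ^ ((t : ℝ) * ((s + 1 : ℕ) * h ((w : ℝ) / t))) *
        ((t : ℝ) + 1) := by rw [← Finset.mul_sum, sum_inv_choose_univ]
    _ ≤ (2 : ℝ) ^ (-((t : ℝ) * ν)) *
        (((t : ℝ) + 1) ^ (s + 1) * (Fintype.card (ConstWt t w) : ℝ) ^ (s + 1)) *
        ((t : ℝ) + 1) := by
        gcongr
        exact two_rpow_mul_h_le_card hw (s + 1)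
    _ = _ := by rw [pow_add]; ring

/-- Given the first `d` columns, each of the other `m` is one of at most `(d * w).choose w` subsets
of their Boolean sum, whatever its weight. The exponent is therefore `m` times that of a single
covered column, and no minimum over types enters. -/
theorem card_coverBad_le {t w d m : ℕ} (ht : 0 < t) (hw : w ≤ t) (hd : 1 ≤ d) {ν : ℝ}
    (hE : ν ≤ R₂ d ((w : ℝ) / t)) :
    ((coverBad t w d m).card : ℝ)
      ≤ ((t : ℝ) + 1) ^ m * (2 : ℝ) ^ (-((t : ℝ) * (m * ν))) *
        (Fintype.card (ConstWt t w) : ℝ) ^ (d + m) := by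
  have ht' : (0 : ℝ) < t := by exact_mod_cast ht
  have h1 : (coverBad t w d m).card ≤ (Fintype.card (ConstWt t w)) ^ d * ((d * w).choose w) ^ m := by
    calc (coverBad t w d m).card
        ≤ ∑ U : Finset (Fin t), (unionFiber d w U).card * (U.card.choose w) ^ m :=
          card_coverBad_le_sum t w d m
      _ ≤ ∑ U : Finset (Fin t), (unionFiber d w U).card * ((d * w).choose w) ^ m := by
          refine Finset.sum_le_sum fun U _ => ?_
          rcases Finset.eq_empty_or_nonempty (unionFiber d w U) with h0 | ⟨x, hx⟩
          · simp [h0]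
          rw [mem_unionFiber] at hx
          have := card_unionOf_le x
          rw [hx] at this
          gcongr
      _ = _ := by
          rw [← Finset.sum_mul]
          congr 1
          have := Finset.card_eq_sum_card_fiberwise
            (s := (Finset.univ : Finset (Fin d → ConstWt t w))) (f := unionOf)
            (t := Finset.univ) (fun _ _ => Finset.mem_coe.2 (Finset.mem_univ _))
          simpa [unionFiber, Fintype.card_pi] using this.symm
  have h2 : (((d * w).choose w : ℕ) : ℝ) ≤ (2 : ℝ) ^ ((t : ℝ) * (d * ((w : ℝ) / t) * h (1 / d))) := by
    have hdw : w ≤ d * w := Nat.le_mul_of_pos_left w hd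
    have := choose_mul_two_rpow_le hdw
    rw [Real.rpow_neg (by norm_num), ← div_eq_mul_inv, div_le_one (by positivity)] at this
    refine this.trans (le_of_eq ?_)
    congr 1
    rcases Nat.eq_zero_or_pos w with rfl | hw0
    · simp
    have : (w : ℝ) ≠ 0 := by exact_mod_cast hw0.ne'
    have hd' : (d : ℝ) ≠ 0 := by exact_mod_cast (Nat.pos_iff_ne_zero.1 hd)
    have e : (w : ℝ) / (d * w : ℕ) = 1 / d := by push_cast; field_simp
    rw [e]
    push_cast
    field_simp
  have h3 : (((d * w).choose w : ℕ) : ℝ)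
      ≤ ((t : ℝ) + 1) * (2 : ℝ) ^ (-((t : ℝ) * ν)) * Fintype.card (ConstWt t w) := by
    rw [card_constWt]
    calc _ ≤ _ := h2
      _ ≤ (2 : ℝ) ^ (-((t : ℝ) * ν)) * (2 : ℝ) ^ ((t : ℝ) * h ((w : ℝ) / t)) := by
          rw [← Real.rpow_add (by norm_num)]
          refine Real.rpow_le_rpow_of_exponent_le (by norm_num) ?_
          have := mul_le_mul_of_nonneg_left hE ht'.le
          rw [R₂] at this
          linarith
      _ ≤ (2 : ℝ) ^ (-((t : ℝ) * ν)) * (((t : ℝ) + 1) * t.choose w) := by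
          gcongr; exact two_rpow_le_choose hw
      _ = _ := by ring
  calc ((coverBad t w d m).card : ℝ)
      ≤ (Fintype.card (ConstWt t w) : ℝ) ^ d * (((d * w).choose w : ℕ) : ℝ) ^ m := by
        exact_mod_cast h1
    _ ≤ (Fintype.card (ConstWt t w) : ℝ) ^ d *
        (((t : ℝ) + 1) * (2 : ℝ) ^ (-((t : ℝ) * ν)) * Fintype.card (ConstWt t w)) ^ m := by gcongr
    _ = _ := by
        rw [mul_pow, mul_pow, ← Real.rpow_natCast ((2 : ℝ) ^ (-((t : ℝ) * ν))) m,
          ← Real.rpow_mul (by norm_num), pow_add]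
        rw [show -((t : ℝ) * ν) * m = -((t : ℝ) * (m * ν)) by ring]
        ring

/-! ### Expurgation -/

/-- A forbidden pattern for a family of elements of `Ω`: a set of families indexed by `κ`. -/
structure Pattern (Ω : Type) where
  κ : Type
  [fintype : Fintype κ]
  [nonempty : Nonempty κ]
  B : Finset (κ → Ω)

attribute [instance] Pattern.fintype Pattern.nonempty

/-- The family `c` contains no forbidden pattern on distinct indices. -/
def Avoids {Ω : Type} {N : ℕ} (c : Fin N → Ω) (P : Pattern Ω) : Prop :=
  ∀ e : P.κ ↪ Fin N, c ∘ e ∉ P.B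

/-- The restriction of a uniform random family to the indices `e` is uniform. As an injection:
exchange the values of `c` along `e` with those of `g`. -/
theorem card_filter_comp_mem_mul_le {Ω κ : Type} [Fintype Ω] [Fintype κ] {n : ℕ}
    (e : κ ↪ Fin n) (B : Finset (κ → Ω)) [DecidablePred fun c : Fin n → Ω => c ∘ e ∈ B] :
    (Finset.univ.filter fun c : Fin n → Ω => c ∘ e ∈ B).card * Fintype.card Ω ^ Fintype.card κ
      ≤ B.card * Fintype.card Ω ^ n := by
  classical
  have h1 : (Finset.univ : Finset (κ → Ω)).card = Fintype.card Ω ^ Fintype.card κ := by simp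
  have h2 : (Finset.univ : Finset (Fin n → Ω)).card = Fintype.card Ω ^ n := by simp
  rw [← h1, ← h2, ← Finset.card_product, ← Finset.card_product]
  refine Finset.card_le_card_of_injOn (fun z => (z.1 ∘ e, Function.extend e z.2 z.1)) ?_ ?_
  · rintro ⟨c, g⟩ hz
    simpa using hz
  · rintro ⟨c, g⟩ - ⟨c', g'⟩ - heq
    simp only [Prod.mk.injEq] at heq
    obtain ⟨h1, h2⟩ := heq
    have hg : g = g' := by
      funext k
      have := congrFun h2 (e k)
      rwa [e.injective.extend_apply, e.injective.extend_apply] at this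
    have hc : c = c' := by
      funext j
      by_cases hj : ∃ k, e k = j
      · obtain ⟨k, rfl⟩ := hj
        exact congrFun h1 k
      · have := congrFun h2 j
        rwa [Function.extend_apply' _ _ _ hj, Function.extend_apply' _ _ _ hj] at this
    rw [hg, hc]

/-- The expurgation method: if the expected number of forbidden patterns in a random family of
`2 * N` elements is less than `N`, some family of `N` elements avoids them. -/
theorem exists_avoids {ι Ω : Type} [Fintype ι] [Fintype Ω] [Nonempty Ω] (P : ι → Pattern Ω) {N : ℕ}
    (hP : ∑ i, ((2 * N : ℕ) : ℝ) ^ Fintype.card (P i).κ *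
      ((P i).B.card / (Fintype.card Ω : ℝ) ^ Fintype.card (P i).κ) < N) :
    ∃ c : Fin N → Ω, ∀ i, Avoids c (P i) := by
  classical
  set n := 2 * N with hn
  set M : ℝ := (Fintype.card Ω : ℝ) with hM
  have hMpos : 0 < M := by
    rw [hM]; exact_mod_cast Fintype.card_pos
  let bad : ∀ i, (Fin n → Ω) → Finset ((P i).κ ↪ Fin n) := fun i c =>
    Finset.univ.filter fun e => c ∘ e ∈ (P i).B
  have hsum : ∑ c : Fin n → Ω, ((∑ i, (bad i c).card : ℕ) : ℝ) < ∑ _c : Fin n → Ω, (N : ℝ) := by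
    have hR : ∑ _c : Fin n → Ω, (N : ℝ) = N * M ^ n := by simp [hM, mul_comm]
    rw [hR]
    push_cast
    rw [Finset.sum_comm]
    refine lt_of_le_of_lt ?_ (mul_lt_mul_of_pos_right hP (pow_pos hMpos n))
    rw [Finset.sum_mul]
    refine Finset.sum_le_sum fun i _ => ?_
    calc ∑ c : Fin n → Ω, ((bad i c).card : ℝ)
        = ∑ e : (P i).κ ↪ Fin n,
          ((Finset.univ.filter fun c : Fin n → Ω => c ∘ e ∈ (P i).B).card : ℝ) := by
          simp only [bad, Finset.card_filter, Nat.cast_sum]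
          exact Finset.sum_comm
      _ ≤ ∑ _e : (P i).κ ↪ Fin n, ((P i).B.card / M ^ Fintype.card (P i).κ) * M ^ n := by
          refine Finset.sum_le_sum fun e _ => ?_
          rw [div_mul_eq_mul_div, le_div_iff₀ (pow_pos hMpos _), hM]
          exact_mod_cast card_filter_comp_mem_mul_le e (P i).B
      _ ≤ _ := by
          rw [Finset.sum_const, nsmul_eq_mul, mul_assoc]
          refine mul_le_mul_of_nonneg_right ?_ (by positivity)
          have : Fintype.card ((P i).κ ↪ Fin n) ≤ n ^ Fintype.card (P i).κ := by
            have := Fintype.card_le_of_injective (fun e : (P i).κ ↪ Fin n => (e : (P i).κ → Fin n))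
              DFunLike.coe_injective
            simpa only [Fintype.card_fun, Fintype.card_fin] using this
          rw [Finset.card_univ]
          exact_mod_cast this
  obtain ⟨c, -, hc⟩ := Finset.exists_lt_of_sum_lt hsum
  have hc : ∑ i, (bad i c).card < N := by exact_mod_cast hc
  -- One index is removed from each occurrence of a pattern, which is why patterns are indexed by
  -- nonempty types.
  let S : Finset (Fin n) := Finset.univ.biUnion fun i =>
    (bad i c).image fun e => e (Classical.arbitrary _)
  have hS : S.card < N :=
    (Finset.card_biUnion_le.trans (Finset.sum_le_sum fun i _ => Finset.card_image_le)).trans_lt hc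
  have hN : N ≤ Sᶜ.card := by
    rw [Finset.card_compl, Fintype.card_fin]; omega
  obtain ⟨V, hV, hVN⟩ := Finset.exists_subset_card_eq hN
  let f := V.orderEmbOfFin hVN
  refine ⟨c ∘ f, fun i e he => ?_⟩
  have hmem : (e.trans f.toEmbedding) ∈ bad i c := Finset.mem_filter.2 ⟨Finset.mem_univ _, he⟩
  have h1 : f (e (Classical.arbitrary _)) ∈ S :=
    Finset.mem_biUnion.2 ⟨i, Finset.mem_univ _, Finset.mem_image.2 ⟨_, hmem, rfl⟩⟩
  exact Finset.mem_compl.1 (hV (V.orderEmbOfFin_mem hVN _)) h1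

/-! ### Asymptotics of the expected number of patterns -/

theorem tendsto_pow_mul_two_rpow_neg (a : ℕ) {δ : ℝ} (hδ : 0 < δ) :
    Tendsto (fun t : ℕ => ((t : ℝ) + 1) ^ a * (2 : ℝ) ^ (-((t : ℝ) * δ))) atTop (𝓝 0) := by
  have hr : |(2 : ℝ) ^ (-δ)| < 1 := by
    rw [abs_of_pos (by positivity)]
    exact Real.rpow_lt_one_of_one_lt_of_neg one_lt_two (by linarith)
  have := (tendsto_add_atTop_iff_nat 1).2 (tendsto_pow_const_mul_const_pow_of_abs_lt_one a hr)
  have := this.mul_const ((2 : ℝ) ^ δ)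
  rw [zero_mul] at this
  refine this.congr fun t => ?_
  push_cast
  rw [mul_assoc, ← Real.rpow_natCast ((2 : ℝ) ^ (-δ)), ← Real.rpow_mul (by norm_num),
    ← Real.rpow_add (by norm_num)]
  congr 2
  push_cast
  ring

/-- The number of columns of a code of length `t` and rate at least `R`. -/
noncomputable def codeSize (R : ℝ) (t : ℕ) : ℕ := ⌈(2 : ℝ) ^ (R * t)⌉₊

theorem le_codeSize (R : ℝ) (t : ℕ) : (2 : ℝ) ^ (R * t) ≤ codeSize R t := Nat.le_ceil _

theorem codeSize_le {R : ℝ} (hR : 0 < R) (t : ℕ) : (codeSize R t : ℝ) ≤ 2 * (2 : ℝ) ^ (R * t) := by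
  have h1 : (1 : ℝ) ≤ (2 : ℝ) ^ (R * t) := Real.one_le_rpow (by norm_num) (by positivity)
  have := Nat.ceil_lt_add_one (zero_le_one.trans h1)
  unfold codeSize
  linarith

theorem tendsto_codeSize {R : ℝ} (hR : 0 < R) :
    Tendsto (fun t => (codeSize R t : ℝ)) atTop atTop := by
  refine tendsto_atTop_mono (le_codeSize R) ?_
  exact (tendsto_rpow_atTop_of_base_gt_one 2 one_lt_two).comp
    (tendsto_natCast_atTop_atTop.const_mul_atTop hR)

/-- One factor `codeSize R t` is kept; the other `r - 1` grow like `2 ^ ((r - 1) * R * t)`, and `hμ`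
leaves an exponential decay that absorbs the polynomial and the constants. -/
theorem eventually_pow_codeSize_le {R μ : ℝ} (hR : 0 < R) {r : ℕ} (hr : 1 ≤ r) (a : ℕ)
    (hμ : ((r : ℝ) - 1) * R < μ) {K : ℝ} (hK : 0 < K) :
    ∀ᶠ t : ℕ in atTop, ((2 * codeSize R t : ℕ) : ℝ) ^ r *
      (((t : ℝ) + 1) ^ a * (2 : ℝ) ^ (-((t : ℝ) * μ))) ≤ codeSize R t * K := by
  obtain ⟨k, rfl⟩ := Nat.exists_eq_add_of_le' hr
  have hδ : 0 < μ - k * R := by push_cast at hμ; linarith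
  have hpos : 0 < K / (2 ^ (k + 1) * 2 ^ k) := by positivity
  filter_upwards [(tendsto_pow_mul_two_rpow_neg a hδ).eventually (gt_mem_nhds hpos)] with t ht
  rw [lt_div_iff₀ (by positivity)] at ht
  have e : (2 : ℝ) ^ (-((t : ℝ) * (μ - k * R)))
      = ((2 : ℝ) ^ (R * t)) ^ k * (2 : ℝ) ^ (-((t : ℝ) * μ)) := by
    rw [← Real.rpow_natCast ((2 : ℝ) ^ (R * t)), ← Real.rpow_mul (by norm_num),
      ← Real.rpow_add (by norm_num)]
    congr 1
    ring
  rw [e] at ht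
  have hN := codeSize_le hR t
  push_cast
  calc (2 * (codeSize R t : ℝ)) ^ (k + 1) * (((t : ℝ) + 1) ^ a * (2 : ℝ) ^ (-((t : ℝ) * μ)))
      = codeSize R t * (2 ^ (k + 1) * (codeSize R t : ℝ) ^ k *
        (((t : ℝ) + 1) ^ a * (2 : ℝ) ^ (-((t : ℝ) * μ)))) := by ring
    _ ≤ codeSize R t * (2 ^ (k + 1) * (2 * (2 : ℝ) ^ (R * t)) ^ k *
        (((t : ℝ) + 1) ^ a * (2 : ℝ) ^ (-((t : ℝ) * μ)))) := by gcongr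
    _ = codeSize R t * (((t : ℝ) + 1) ^ a * (((2 : ℝ) ^ (R * t)) ^ k *
        (2 : ℝ) ^ (-((t : ℝ) * μ))) * (2 ^ (k + 1) * 2 ^ k)) := by ring
    _ ≤ _ := mul_le_mul_of_nonneg_left ht.le (by positivity)

/-- Patterns of `r` columns whose probability is of exponent greater than `(r - 1) * R` can be
avoided at rate `R`. -/
theorem eventually_exists_avoids {ι : Type} [Fintype ι] {w : ℕ → ℕ} (hw : ∀ t, w t ≤ t)
    (P : ∀ t, ι → Pattern (ConstWt t (w t))) {R : ℝ} (hR : 0 < R)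
    (hP : ∀ i, ∃ (r a : ℕ) (μ : ℝ), ((r : ℝ) - 1) * R < μ ∧
      (∀ t, Fintype.card (P t i).κ = r) ∧
      ∀ᶠ t : ℕ in atTop, ((P t i).B.card : ℝ) ≤ ((t : ℝ) + 1) ^ a * (2 : ℝ) ^ (-((t : ℝ) * μ)) *
        (Fintype.card (ConstWt t (w t)) : ℝ) ^ r) :
    ∀ᶠ t : ℕ in atTop, ∃ c : Fin (codeSize R t) → ConstWt t (w t), ∀ i, Avoids c (P t i) := by
  choose r a μ hμ hr hev using hP
  have hr1 : ∀ i, 1 ≤ r i := fun i => by rw [← hr i 0]; exact Fintype.card_pos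
  have hK : (0 : ℝ) < 1 / (Fintype.card ι + 1) := by positivity
  filter_upwards [eventually_all.2 hev,
    eventually_all.2 fun i => eventually_pow_codeSize_le hR (hr1 i) (a i) (hμ i) hK,
    (tendsto_codeSize hR).eventually_gt_atTop 0] with t h1 h2 hN
  have hcard : 0 < Fintype.card (ConstWt t (w t)) := by
    rw [card_constWt]; exact Nat.choose_pos (hw t)
  have : Nonempty (ConstWt t (w t)) := Fintype.card_pos_iff.1 hcard
  have hcard' : (0 : ℝ) < Fintype.card (ConstWt t (w t)) := by exact_mod_cast hcard
  refine exists_avoids (P t) ?_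
  calc _ ≤ ∑ _i : ι, (codeSize R t : ℝ) * (1 / (Fintype.card ι + 1)) := by
        refine Finset.sum_le_sum fun i _ => le_trans ?_ (h2 i)
        rw [hr i t]
        gcongr
        rw [div_le_iff₀ (pow_pos hcard' _)]
        exact h1 i
    _ < _ := by
        rw [Finset.sum_const, nsmul_eq_mul, Finset.card_univ]
        have : (0 : ℝ) < Fintype.card ι + 1 := by positivity
        rw [mul_left_comm, mul_one_div]
        refine mul_lt_of_lt_one_right hN ?_
        rw [div_lt_one this]
        linarith

/-! ### From families avoiding patterns to codes -/

/-- The binary matrix with given columns. -/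
def codeOf {t w N : ℕ} (c : Fin N → ConstWt t w) : Matrix (Fin t) (Fin N) Bool :=
  fun i j => decide (i ∈ (c j).1)

theorem outcome_codeOf {t w N : ℕ} (c : Fin N → ConstWt t w) (D : Finset (Fin N)) (i : Fin t) :
    outcome (codeOf c) D i = true ↔ ∃ j ∈ D, i ∈ (c j).1 := by
  classical
  induction D using Finset.induction_on with
  | empty => simp [outcome]
  | insert a s _ ih =>
    rw [outcome, Finset.sup_insert, ← outcome, Pi.sup_apply, show ∀ x y : Bool, x ⊔ y = (x || y) from fun _ _ => rfl,
      Bool.or_eq_true, ih]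
    simp [column, codeOf]

theorem covers_codeOf {t w N : ℕ} {c : Fin N → ConstWt t w} {D : Finset (Fin N)} {j : Fin N}
    (H : Covers (outcome (codeOf c) D) (column (codeOf c) j)) {i : Fin t} (hi : i ∈ (c j).1) :
    ∃ k ∈ D, i ∈ (c k).1 := by
  rw [← outcome_codeOf]
  have := congrFun H i
  rw [← this]
  simp [column, codeOf, hi]

theorem mem_unionOf_orderEmbOfFin {t w N k : ℕ} {c : Fin N → ConstWt t w} {S : Finset (Fin N)}
    (hS : S.card = k) {i : Fin t} :
    i ∈ unionOf (fun l => c (S.orderEmbOfFin hS l)) ↔ ∃ j ∈ S, i ∈ (c j).1 := by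
  rw [mem_unionOf]
  constructor
  · rintro ⟨l, hl⟩
    exact ⟨_, S.orderEmbOfFin_mem hS l, hl⟩
  · rintro ⟨j, hj, hi⟩
    obtain ⟨l, rfl⟩ : j ∈ Set.range (S.orderEmbOfFin hS) := by
      rw [Finset.range_orderEmbOfFin]; exact hj
    exact ⟨l, hi⟩

/-- The enumeration of two disjoint finite sets. -/
def sumEnum {N k l : ℕ} {S T : Finset (Fin N)} (hS : S.card = k) (hT : T.card = l)
    (H : Disjoint S T) : Fin k ⊕ Fin l ↪ Fin N where
  toFun := Sum.elim (S.orderEmbOfFin hS) (T.orderEmbOfFin hT)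
  inj' := (S.orderEmbOfFin hS).injective.sumElim (T.orderEmbOfFin hT).injective fun i j e =>
    Finset.disjoint_left.1 H (S.orderEmbOfFin_mem hS i) (e ▸ T.orderEmbOfFin_mem hT j)

theorem sumEnum_mem {N k l : ℕ} {S T : Finset (Fin N)} (hS : S.card = k) (hT : T.card = l)
    (H : Disjoint S T) (i : Fin k ⊕ Fin l) : sumEnum hS hT H i ∈ S ∪ T := by
  rcases i with i | i
  · exact Finset.mem_union_left _ (S.orderEmbOfFin_mem hS i)
  · exact Finset.mem_union_right _ (T.orderEmbOfFin_mem hT i)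

/-- The pattern of `s` columns covering `m` others. -/
def coverPattern (t w s m : ℕ) (hm : 0 < m) : Pattern (ConstWt t w) where
  κ := Fin s ⊕ Fin m
  nonempty := ⟨Sum.inr ⟨0, hm⟩⟩
  B := coverBad t w s m

/-- The pattern of two sets of `a + b` columns with `a` common columns and the same Boolean sum. -/
def pairPattern (t w a b : ℕ) (hb : 0 < b) : Pattern (ConstWt t w) where
  κ := Fin a ⊕ (Fin b ⊕ Fin b)
  nonempty := ⟨Sum.inr (Sum.inl ⟨0, hb⟩)⟩
  B := pairBad t w a b

theorem Avoids.exists_not_covered {t w N s m : ℕ} {hm : 0 < m} {c : Fin N → ConstWt t w}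
    (hc : Avoids c (coverPattern t w s m hm)) {S T : Finset (Fin N)} (hS : S.card = s)
    (hT : T.card = m) (H : Disjoint S T) :
    ∃ j ∈ T, ∃ i ∈ (c j).1, ∀ k ∈ S, i ∉ (c k).1 := by
  by_contra hcon
  push Not at hcon
  refine hc (sumEnum hS hT H) (mem_coverBad.2 fun j i hi => ?_)
  obtain ⟨k, hk, hik⟩ := hcon _ (T.orderEmbOfFin_mem hT j) i hi
  exact (mem_unionOf_orderEmbOfFin hS).2 ⟨k, hk, hik⟩

theorem isUnionFreeLE_codeOf {t w N d : ℕ} (hd : 1 ≤ d) (hN : d ≤ N) {c : Fin N → ConstWt t w}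
    (hcov : Avoids c (coverPattern t w (d - 1) 1 one_pos))
    (hpair : ∀ d₀ : Fin d, Avoids c (pairPattern t w d₀ (d - d₀) (Nat.sub_pos_of_lt d₀.2))) :
    IsUnionFreeLE d (codeOf c) := by
  classical
  have hdisj : ∀ S : Finset (Fin N), S.card ≤ d - 1 → ∀ j ∉ S,
      ∃ i ∈ (c j).1, ∀ k ∈ S, i ∉ (c k).1 := fun S hS j hj => by
    -- The pattern has exactly `d - 1` covering columns, so a smaller set is first enlarged without
    -- reaching `j`; `d ≤ N` leaves enough columns.
    obtain ⟨S', hSS', hS'j, hS'⟩ := Finset.exists_subsuperset_card_eq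
      (s := S) (t := Finset.univ.erase j) (n := d - 1)
      (fun x hx => Finset.mem_erase.2 ⟨fun e => hj (e ▸ hx), Finset.mem_univ _⟩) hS
      (by rw [Finset.card_erase_of_mem (Finset.mem_univ _), Finset.card_univ, Fintype.card_fin]
          omega)
    obtain ⟨j', hj', i, hi, hk⟩ := hcov.exists_not_covered hS' (Finset.card_singleton j)
      (Finset.disjoint_singleton_right.2 fun hjS => (Finset.mem_erase.1 (hS'j hjS)).1 rfl)
    rw [Finset.mem_singleton] at hj'
    subst hj'
    exact ⟨i, hi, fun k hkS => hk k (hSS' hkS)⟩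
  intro D₁ D₂ h₁ h₂ hne heq
  have hiff : ∀ i, (∃ j ∈ D₁, i ∈ (c j).1) ↔ ∃ j ∈ D₂, i ∈ (c j).1 := fun i => by
    rw [← outcome_codeOf, ← outcome_codeOf, heq]
  have hcard : ∀ {D D' : Finset (Fin N)}, D.card ≤ d →
      (∀ i, (∃ j ∈ D', i ∈ (c j).1) → ∃ j ∈ D, i ∈ (c j).1) → ¬ D' ⊆ D → D.card = d :=
    fun {D D'} hD himp hsub => by
      by_contra hDd
      obtain ⟨j, hj', hj⟩ := Finset.not_subset.1 hsub
      obtain ⟨i, hi, hk⟩ := hdisj D (by omega) j hj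
      obtain ⟨k, hkD, hik⟩ := himp i ⟨j, hj', hi⟩
      exact hk k hkD hik
  -- Fewer than `d` columns cover no further column, so a set of columns not containing the other
  -- set has `d` elements. A proper inclusion would force the smaller set to have `d` elements
  -- already.
  have hboth : D₁.card = d ∧ D₂.card = d := by
    by_cases hsub : D₂ ⊆ D₁
    · have hsub' : ¬ D₁ ⊆ D₂ := fun hs => hne (hs.antisymm hsub)
      have e₂ := hcard h₂ (fun i => (hiff i).1) hsub'
      exact absurd (Finset.eq_of_subset_of_card_le hsub (by omega)).symm hne
    · have e₁ := hcard h₁ (fun i => (hiff i).2) hsub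
      refine ⟨e₁, hcard h₂ (fun i => (hiff i).1) fun hs => ?_⟩
      exact hne (Finset.eq_of_subset_of_card_le hs (by omega))
  obtain ⟨e₁, e₂⟩ := hboth
  have i₁ := Finset.card_inter_add_card_sdiff D₁ D₂
  have i₂ := Finset.card_inter_add_card_sdiff D₂ D₁
  rw [Finset.inter_comm] at i₂
  have hlt : (D₁ ∩ D₂).card < d := by
    refine lt_of_le_of_ne (e₁ ▸ Finset.card_le_card Finset.inter_subset_left) fun he => hne ?_
    have a₁ := Finset.eq_of_subset_of_card_le (Finset.inter_subset_left (s₁ := D₁) (s₂ := D₂))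
      (by omega)
    have a₂ := Finset.eq_of_subset_of_card_le (Finset.inter_subset_right (s₁ := D₁) (s₂ := D₂))
      (by omega)
    exact a₁.symm.trans a₂
  have c₁ : (D₁ \ D₂).card = d - (D₁ ∩ D₂).card := by omega
  have c₂ : (D₂ \ D₁).card = d - (D₁ ∩ D₂).card := by omega
  have hdd : Disjoint (D₁ \ D₂) (D₂ \ D₁) := by
    rw [Finset.disjoint_left]
    intro x hx hx'
    exact (Finset.mem_sdiff.1 hx).2 (Finset.mem_sdiff.1 hx').1
  let f := sumEnum c₁ c₂ hdd
  let g := (D₁ ∩ D₂).orderEmbOfFin rfl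
  let e : Fin (D₁ ∩ D₂).card ⊕ (Fin (d - (D₁ ∩ D₂).card) ⊕ Fin (d - (D₁ ∩ D₂).card)) ↪ Fin N :=
    ⟨Sum.elim g f, g.injective.sumElim f.injective fun i j hij => by
      have m1 := (D₁ ∩ D₂).orderEmbOfFin_mem rfl i
      have m2 := sumEnum_mem c₁ c₂ hdd j
      change g i ∈ _ at m1
      change f j ∈ _ at m2
      rw [← hij] at m2
      simp only [Finset.mem_union, Finset.mem_sdiff, Finset.mem_inter] at m1 m2
      tauto⟩
  refine hpair ⟨_, hlt⟩ e (mem_pairBad.2 ?_)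
  have split : ∀ (A B : Finset (Fin N)) (i : Fin t),
      ((∃ j ∈ A ∩ B, i ∈ (c j).1) ∨ ∃ j ∈ A \ B, i ∈ (c j).1) ↔ ∃ j ∈ A, i ∈ (c j).1 := by
    intro A B i
    simp only [Finset.mem_inter, Finset.mem_sdiff, ← exists_or]
    refine exists_congr fun j => ?_
    tauto
  ext i
  rw [Finset.mem_union, Finset.mem_union]
  have u₀ : i ∈ unionOf ((c ∘ e) ∘ Sum.inl) ↔ ∃ j ∈ D₁ ∩ D₂, i ∈ (c j).1 :=
    mem_unionOf_orderEmbOfFin rfl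
  have u₁ : i ∈ unionOf ((c ∘ e) ∘ Sum.inr ∘ Sum.inl) ↔ ∃ j ∈ D₁ \ D₂, i ∈ (c j).1 :=
    mem_unionOf_orderEmbOfFin c₁
  have u₂ : i ∈ unionOf ((c ∘ e) ∘ Sum.inr ∘ Sum.inr) ↔ ∃ j ∈ D₂ \ D₁, i ∈ (c j).1 :=
    mem_unionOf_orderEmbOfFin c₂
  have s₁ := split D₁ D₂ i
  have s₂ := split D₂ D₁ i
  rw [Finset.inter_comm] at s₂
  refine (or_congr u₀ u₁).trans (s₁.trans ((hiff i).trans (s₂.symm.trans (or_congr u₀ u₂).symm)))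

/-- Enlarge `D` to `d` columns. Were more than `d + m` columns covered, at least `m` of them would
lie outside the enlarged set and form the forbidden pattern. -/
theorem ncard_covers_codeOf_le {t w N d m : ℕ} (hN : d ≤ N) {hm : 0 < m}
    {c : Fin N → ConstWt t w} (hcov : Avoids c (coverPattern t w d m hm)) {D : Finset (Fin N)}
    (hD : D.card ≤ d) :
    ({j : Fin N | Covers (outcome (codeOf c) D) (column (codeOf c) j)} : Set (Fin N)).ncard
      ≤ d + m := by
  classical
  obtain ⟨D', hDD', -, hD'⟩ := Finset.exists_subsuperset_card_eq (Finset.subset_univ D) hD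
    (by rwa [Finset.card_univ, Fintype.card_fin])
  set Z : Finset (Fin N) :=
    Finset.univ.filter fun j => Covers (outcome (codeOf c) D) (column (codeOf c) j) with hZ
  have hcoe : {j : Fin N | Covers (outcome (codeOf c) D) (column (codeOf c) j)} = (Z : Set _) := by
    ext j; simp [hZ]
  rw [hcoe, Set.ncard_coe_finset]
  by_contra! hlt
  have hle : m ≤ (Z \ D').card := by
    have := Finset.le_card_sdiff D' Z
    omega
  obtain ⟨T, hT, hTm⟩ := Finset.exists_subset_card_eq hle
  obtain ⟨j, hj, i, hi, hk⟩ := hcov.exists_not_covered hD' hTm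
    (Finset.disjoint_right.2 fun x hx => (Finset.mem_sdiff.1 (hT hx)).2)
  obtain ⟨k, hkD, hik⟩ :=
    covers_codeOf (Finset.mem_filter.1 (Finset.mem_sdiff.1 (hT hj)).1).2 hi
  exact hk k (hDD' hkD) hik

/-! ### Lower bounds on the rates -/

theorem rateUF_nonneg (d : ℕ) : 0 ≤ rateUF d := by
  refine le_limsup_of_frequently_le (Eventually.frequently (Eventually.of_forall fun t => ?_))
  refine EReal.coe_nonneg.2 (div_nonneg ?_ (by positivity))
  exact div_nonneg (Real.log_natCast_nonneg _) (Real.log_nonneg (by norm_num))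

theorem rateUFFD_nonneg (d : ℕ) : 0 ≤ rateUFFD d := by
  refine le_limsup_of_frequently_le (Eventually.frequently (Eventually.of_forall fun t => ?_))
  refine EReal.coe_nonneg.2 (div_nonneg ?_ (by positivity))
  exact div_nonneg (Real.log_natCast_nonneg _) (Real.log_nonneg (by norm_num))

theorem le_logb_div_of_codeSize_le {R : ℝ} {t n : ℕ} (ht : 0 < t) (hn : codeSize R t ≤ n) :
    R ≤ Real.logb 2 n / t := by
  have ht' : (0 : ℝ) < t := by exact_mod_cast ht
  have h1 : (2 : ℝ) ^ (R * t) ≤ n := (le_codeSize R t).trans (by exact_mod_cast hn)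
  rw [le_div_iff₀ ht', Real.le_logb_iff_rpow_le one_lt_two ((by positivity : (0 : ℝ) <
    (2 : ℝ) ^ (R * t)).trans_le h1)]
  exact h1

theorem le_rateUF {d : ℕ} (hd : 1 ≤ d) {R : ℝ}
    (H : ∀ᶠ t in atTop, ∃ C : Matrix (Fin t) (Fin (codeSize R t)) Bool, IsUnionFreeLE d C) :
    (R : EReal) ≤ rateUF d := by
  refine le_limsup_of_frequently_le (Eventually.frequently ?_)
  filter_upwards [H, eventually_gt_atTop 0] with t hC ht
  refine EReal.coe_le_coe_iff.2 (le_logb_div_of_codeSize_le ht ?_)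
  exact le_csSup ⟨2 ^ t, fun n ⟨C, hC⟩ => hC.card_le hd⟩ hC

theorem le_rateUFFD {d : ℕ} (hd : 1 ≤ d) {R : ℝ}
    (H : ∀ᶠ t in atTop, ∃ C : Matrix (Fin t) (Fin (codeSize R t)) Bool, IsUFFDLE d C) :
    (R : EReal) ≤ rateUFFD d := by
  refine le_limsup_of_frequently_le (Eventually.frequently ?_)
  filter_upwards [H, eventually_gt_atTop 0] with t hC ht
  refine EReal.coe_le_coe_iff.2 (le_logb_div_of_codeSize_le ht ?_)
  exact le_csSup ⟨2 ^ t, fun n ⟨C, hC⟩ => hC.1.card_le hd⟩ hC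

/-- The weight of the columns of the random code of length `t`. -/
noncomputable def colWeight (p : ℝ) (t : ℕ) : ℕ := ⌊p * t⌋₊

theorem colWeight_le {p : ℝ} (hp : p ≤ 1) (t : ℕ) : colWeight p t ≤ t := by
  refine Nat.floor_le_of_le ?_
  exact mul_le_of_le_one_left (by positivity) hp

theorem tendsto_colWeight {p : ℝ} (hp : 0 ≤ p) :
    Tendsto (fun t : ℕ => (colWeight p t : ℝ) / t) atTop (𝓝 p) :=
  (tendsto_nat_floor_mul_div_atTop hp).comp tendsto_natCast_atTop_atTop

/-- The patterns to be avoided by a union-free code. -/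
def unionFreePattern (d t w : ℕ) : Option (Fin d) → Pattern (ConstWt t w)
  | none => coverPattern t w (d - 1) 1 one_pos
  | some d₀ => pairPattern t w d₀ (d - d₀) (Nat.sub_pos_of_lt d₀.2)

/-- The patterns to be avoided by a union-free code with fast decoding. -/
def fastDecodingPattern (d m : ℕ) (hm : 0 < m) (t w : ℕ) :
    Option (Option (Fin d)) → Pattern (ConstWt t w)
  | none => coverPattern t w d m hm
  | some i => unionFreePattern d t w i

theorem lt_disj_of_lt_lbDisj {s : ℕ} (hs : 1 ≤ s) {p R : ℝ} (H : (R : EReal) < lbDisj s p) :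
    ∃ ν', s * R < ν' ∧
      ∀ y ∈ Ioo (0 : ℝ) 1, q s p y ≤ 1 → ν' ≤ A s p y + h p - q s p y * h (p / q s p y) := by
  obtain ⟨R', h1, h2⟩ := EReal.lt_iff_exists_real_btwn.1 H
  have hs' : (0 : ℝ) < s := by exact_mod_cast hs
  refine ⟨s * R', mul_lt_mul_of_pos_left (EReal.coe_lt_coe_iff.1 h1) hs', fun y hy hq => ?_⟩
  have : lbDisj s p ≤ _ := iInf_le_of_le y (iInf_le_of_le hy (iInf_le _ hq))
  have := EReal.coe_le_coe_iff.1 (h2.le.trans this)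
  rw [one_div, inv_mul_eq_div, le_div_iff₀ hs'] at this
  linarith

theorem lt_pair_of_lt_lbUFEq {d d₀ : ℕ} (hd : d₀ < d) (hd2 : 2 ≤ d) {p R : ℝ}
    (H : (R : EReal) < lbUFEq d p) :
    ∃ ν', (2 * (d : ℝ) - d₀ - 1) * R < ν' ∧ ∀ α y₀ y₁ y₂, Admissible d d₀ p α y₀ y₁ y₂ →
      ν' ≤ (2 * (d : ℝ) - d₀ - 1) * R₁ d d₀ p α y₀ y₁ y₂ := by
  obtain ⟨R', h1, h2⟩ := EReal.lt_iff_exists_real_btwn.1 H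
  have hpos : (0 : ℝ) < 2 * (d : ℝ) - d₀ - 1 := by
    have h1 : (d₀ : ℝ) + 1 ≤ d := by exact_mod_cast hd
    have h2 : (2 : ℝ) ≤ d := by exact_mod_cast hd2
    linarith
  refine ⟨_, mul_lt_mul_of_pos_left (EReal.coe_lt_coe_iff.1 h1) hpos, fun α y₀ y₁ y₂ ha => ?_⟩
  refine mul_le_mul_of_nonneg_left (EReal.coe_le_coe_iff.1 (h2.le.trans ?_)) hpos.le
  exact iInf_le_of_le d₀ (iInf_le_of_le α (iInf_le_of_le y₀ (iInf_le_of_le y₁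
    (iInf_le_of_le y₂ (iInf_le _ ha)))))

/-- The patterns of a union-free code are rare at rates below the random-coding bounds. -/
theorem unionFreePattern_rare {d : ℕ} (hd : 2 ≤ d) {p R : ℝ} (hp : p ∈ Ioo (0 : ℝ) 1)
    (h₁ : (R : EReal) < lbDisj (d - 1) p) (h₂ : (R : EReal) < lbUFEq d p) (i : Option (Fin d)) :
    ∃ (r a : ℕ) (μ : ℝ), ((r : ℝ) - 1) * R < μ ∧
      (∀ t, Fintype.card (unionFreePattern d t (colWeight p t) i).κ = r) ∧
      ∀ᶠ t : ℕ in atTop, ((unionFreePattern d t (colWeight p t) i).B.card : ℝ)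
        ≤ ((t : ℝ) + 1) ^ a * (2 : ℝ) ^ (-((t : ℝ) * μ)) *
          (Fintype.card (ConstWt t (colWeight p t)) : ℝ) ^ r := by
  rcases i with _ | ⟨d₀, hd₀⟩
  · obtain ⟨ν', hν', hA⟩ := lt_disj_of_lt_lbDisj (by omega) h₁
    obtain ⟨ν, hν1, hν2⟩ := exists_between hν'
    refine ⟨(d - 1) + 1, 1 + ((d - 1) + 1), ν, ?_, fun t => ?_, ?_⟩
    · push_cast at hν1 ⊢; linarith
    · change Fintype.card (Fin (d - 1) ⊕ Fin 1) = _
      simp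
    · filter_upwards [(tendsto_colWeight hp.1.le).eventually
        (eventually_disjExponent (by omega) hp hν2 hA), eventually_gt_atTop 0] with t hE ht
      exact card_coverBad_one_le ht (colWeight_le hp.2.le t) (by omega) hE
  · obtain ⟨ν', hν', hA⟩ := lt_pair_of_lt_lbUFEq hd₀ hd h₂
    obtain ⟨ν, hν1, hν2⟩ := exists_between hν'
    refine ⟨d₀ + ((d - d₀) + (d - d₀)), 4 + (d₀ + ((d - d₀) + (d - d₀))), ν, ?_, fun t => ?_, ?_⟩
    · push_cast [Nat.cast_sub hd₀.le]
      convert hν1 using 2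
      ring
    · change Fintype.card (Fin d₀ ⊕ (Fin (d - d₀) ⊕ Fin (d - d₀))) = _
      simp
    · filter_upwards [(tendsto_colWeight hp.1.le).eventually
        (eventually_pairExponent hd₀ hp hν2 hA), eventually_gt_atTop 0] with t hE ht
      exact card_pairBad_le ht (colWeight_le hp.2.le t) hd₀ hE

theorem eventually_le_codeSize {R : ℝ} (hR : 0 < R) (k : ℕ) : ∀ᶠ t in atTop, k ≤ codeSize R t := by
  filter_upwards [(tendsto_codeSize hR).eventually_ge_atTop (k : ℝ)] with t ht
  exact_mod_cast ht

theorem le_rateUF_of_lt {d : ℕ} (hd : 2 ≤ d) {p R : ℝ} (hp : p ∈ Ioo (0 : ℝ) 1) (hR : 0 < R)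
    (h₁ : (R : EReal) < lbDisj (d - 1) p) (h₂ : (R : EReal) < lbUFEq d p) :
    (R : EReal) ≤ rateUF d := by
  refine le_rateUF (by omega) ?_
  filter_upwards [eventually_exists_avoids (colWeight_le hp.2.le)
    (fun t => unionFreePattern d t (colWeight p t)) hR (unionFreePattern_rare hd hp h₁ h₂),
    eventually_le_codeSize hR d] with t ⟨c, hc⟩ hN
  exact ⟨codeOf c, isUnionFreeLE_codeOf (by omega) hN (hc none) fun d₀ => hc (some d₀)⟩

theorem continuous_R₂ (d : ℕ) : Continuous (R₂ d) := by
  have := continuous_h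
  unfold R₂
  fun_prop

theorem le_rateUFFD_of_lt {d : ℕ} (hd : 2 ≤ d) {p R : ℝ} (hp : p ∈ Ioo (0 : ℝ) 1) (hR : 0 < R)
    (h₁ : (R : EReal) < lbDisj (d - 1) p) (h₂ : (R : EReal) < lbUFEq d p) (h₃ : R < R₂ d p) :
    (R : EReal) ≤ rateUFFD d := by
  obtain ⟨R', hR1, hR2⟩ := exists_between h₃
  have hd' : (2 : ℝ) ≤ d := by exact_mod_cast hd
  -- The choice of `m` amounts to `(d + m - 1) * R < m * R'`, the rarity condition for the pattern
  -- of `d` columns covering `m` others.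
  obtain ⟨m, hm⟩ := exists_nat_gt ((d - 1) * R / (R' - R))
  have hgap : 0 < R' - R := by linarith
  rw [div_lt_iff₀ hgap] at hm
  have hm0 : 0 < m := by
    rcases Nat.eq_zero_or_pos m with rfl | h0
    · have : 0 < ((d : ℝ) - 1) * R := mul_pos (by linarith) hR
      simp only [Nat.cast_zero, zero_mul] at hm
      linarith
    · exact h0
  have hrare : ∀ i, ∃ (r a : ℕ) (μ : ℝ), ((r : ℝ) - 1) * R < μ ∧
      (∀ t, Fintype.card (fastDecodingPattern d m hm0 t (colWeight p t) i).κ = r) ∧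
      ∀ᶠ t : ℕ in atTop, ((fastDecodingPattern d m hm0 t (colWeight p t) i).B.card : ℝ)
        ≤ ((t : ℝ) + 1) ^ a * (2 : ℝ) ^ (-((t : ℝ) * μ)) *
          (Fintype.card (ConstWt t (colWeight p t)) : ℝ) ^ r := by
    rintro (_ | i)
    · refine ⟨d + m, m, m * R', ?_, fun t => ?_, ?_⟩
      · push_cast; linarith
      · change Fintype.card (Fin d ⊕ Fin m) = _
        simp
      · filter_upwards [(((continuous_R₂ d).tendsto p).comp
          (tendsto_colWeight hp.1.le)).eventually (lt_mem_nhds hR2), eventually_gt_atTop 0]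
          with t hE ht
        exact card_coverBad_le ht (colWeight_le hp.2.le t) (by omega) hE.le
    · exact unionFreePattern_rare hd hp h₁ h₂ i
  -- As `R > 0`, the allowance `N ^ (1 / d)` is unbounded and eventually exceeds the constant `d +
  -- m`.
  have hpow : Tendsto (fun t => (codeSize R t : ℝ) ^ ((1 : ℝ) / d)) atTop atTop :=
    (tendsto_rpow_atTop (by positivity)).comp (tendsto_codeSize hR)
  refine le_rateUFFD (by omega) ?_
  filter_upwards [eventually_exists_avoids (colWeight_le hp.2.le)
    (fun t => fastDecodingPattern d m hm0 t (colWeight p t)) hR hrare,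
    eventually_le_codeSize hR d, hpow.eventually_ge_atTop ((d + m : ℕ) : ℝ)] with t ⟨c, hc⟩ hN hbig
  refine ⟨codeOf c, isUnionFreeLE_codeOf (by omega) hN (hc (some none))
    fun d₀ => hc (some (some d₀)), fun D hD => le_trans ?_ hbig⟩
  exact_mod_cast ncard_covers_codeOf_le hN (hm := hm0) (hc none) hD

/-- To bound a nonnegative extended real from below it is enough to consider positive reals. -/
theorem le_of_forall_pos_real_lt {a b : EReal} (hb : 0 ≤ b)
    (H : ∀ R : ℝ, 0 < R → (R : EReal) < a → (R : EReal) ≤ b) : a ≤ b := by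
  refine le_of_forall_lt_imp_le_of_dense fun c hc => ?_
  obtain ⟨R, h1, h2⟩ := EReal.lt_iff_exists_real_btwn.1 hc
  rcases le_or_gt R 0 with hR | hR
  · exact h1.le.trans ((EReal.coe_nonpos.2 hR).trans hb)
  · exact h1.le.trans (H R hR h2)

end GroupTesting

theorem theorem3 (d : ℕ) (hd : 2 ≤ d) :
    (⨆ p ∈ Set.Ioo (0 : ℝ) 1, min (GroupTesting.lbDisj (d - 1) p) (GroupTesting.lbUFEq d p))
        ≤ GroupTesting.rateUF d ∧
      (⨆ p ∈ GroupTesting.paramSet d,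
          min (GroupTesting.lbDisj (d - 1) p) (GroupTesting.lbUFFDEq d p))
        ≤ GroupTesting.rateUFFD d := by
  constructor
  · refine iSup₂_le fun p hp => GroupTesting.le_of_forall_pos_real_lt
      (GroupTesting.rateUF_nonneg d) fun R hR hlt => ?_
    obtain ⟨h₁, h₂⟩ := lt_min_iff.1 hlt
    exact GroupTesting.le_rateUF_of_lt hd hp hR h₁ h₂
  · refine iSup₂_le fun p hp => GroupTesting.le_of_forall_pos_real_lt
      (GroupTesting.rateUFFD_nonneg d) fun R hR hlt => ?_
    obtain ⟨h₁, h₂⟩ := lt_min_iff.1 hlt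
    obtain ⟨h₂, h₃⟩ := lt_min_iff.1 h₂
    exact GroupTesting.le_rateUFFD_of_lt hd hp.1 hR h₁ h₂ (EReal.coe_lt_coe_iff.1 h₃)
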